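/- Let $p,q\ge 1$ and $n\ge 0$ be integers. Let $\mathrm{GP}_n^{p,q}$ be the set of generalized permutations, i.e. arrays $\pi=\begin{pmatrix} i_1&\dots&i_n\\ j_1&\dots&j_n\end{pmatrix}$ of integers with $1\le i_1\le\dots\le i_n\le p$, $1\le j_1,\dots,j_n\le q$, and $j_k\le j_{k+1}$ whenever $i_k=i_{k+1}$. Let $\mathrm{Mat}_n^{p,q}$ be the set of $p\times q$ matrices $W=(w_{ij})$ with nonnegative integer entries of total sum $n$. Let $L(\pi)$ be the length $m$ of the longest weakly increasing subsequence $j_{r_1}\le\dots\le j_{r_m}$, $r_1<\dots<r_m$, of $\pi$, and let $L(W)$ be the maximum of $\sum w_{ij}$ over the entries of a path from $(1,1)$ to $(p,q)$ each of whose steps goes one entry to the right or one entry down. A semistandard tableau is a filling of a Young diagram that is weakly increasing along rows and strictly increasing down columns. For a partition $\lambda$, let $\tilde{\mathbf s}_\lambda(x_1,\dots,x_m)=\sum_T\prod_i x_i^{\#\{\text{times } i \text{ appears in } T\}}$ be its Schur polynomial ($T$ running over the semistandard tableaux of shape $\lambda$ with entries in $\{1,\dots,m\}$), and let $\tilde{\mathbf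 s}_\lambda(1^m)$ be its value at $x_1=\dots=x_m=1$. The Robinson–Schensted–Knuth (RSK) algorithm starts from $P=Q=\emptyset$ and processes the columns $\binom{i_k}{j_k}$, $k=1,\dots,n$, as follows. The number $j_k$ is inserted in the first row of $P$: if it is at least all the numbers in that row, it is put in a new box at the end of the row; otherwise it replaces the leftmost number larger than it, and the replaced number is inserted in the next row by the same rule, and so on until a new box is created. Then a box containing $i_k$ is added to $Q$ at the place of the new box of $P$. **Theorem.** 1. The RSK algorithm $\pi\mapsto(P,Q)$ is a bijection from $\mathrm{GP}_n^{p,q}$ onto the set of pairs $(P,Q)$ of semistandard tableaux of the same, arbitrary, shape $\lambda\vdash n$, with $P$ filled with integers from $\{1,\dots,q\}$ and $Q$ filled with integers from $\{1,\dots,p\}$. The map $\pi\mapsto W(\pi)=(w_{ij})$, where $w_{ij}$ is the number of times that the column $\binom ij$ occurs in $\pi$, is a bijection from $\mathrm{GP}_n^{p,q}$ onto $\mathrm{Mat}_n^{p,q}$. 2. Consequently $$\binom{pq+n-1}{n}=\#\mathrm{GP}_n^{p,q}=\sum_{\lambda\vdash n}\tilde{\mathbf s}_\lambda(1^p)\,\tilde{\mathbf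 s}_\lambda(1^q)=\#\mathrm{Mat}_n^{p,q}.$$ 3. For every $\pi\in \mathrm{GP}_n^{p,q}$, with $\lambda$ the common shape of the associated $P$ and $Q$, and $W=W(\pi)$, $$L(\pi)=\lambda_1=L(W),$$ where $\lambda_1$ is the length of the first row of $\lambda$ ($0$ if $n=0$). -/

import Mathlib

namespace RSK

/-! Alphabets are indexed from zero: `{1, …, m}` is represented by `Fin m`, i.e. by the natural
numbers `< m`; likewise row and column indices of matrices and Young diagrams start at zero. -/

/-- Generalized permutations of size `n` over the alphabets `[p]` (top line) and `[q]`
(bottom line). -/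
@[ext]
structure GenPerm (p q n : ℕ) where
  /-- the top line `i₁, …, iₙ` -/
  top : Fin n → Fin p
  /-- the bottom line `j₁, …, jₙ` -/
  bot : Fin n → Fin q
  top_mono : Monotone top
  bot_le : ∀ k l : Fin n, (k : ℕ) + 1 = l → top k = top l → bot k ≤ bot l

/-- `p × q` matrices with nonnegative integer entries of total sum `n`. -/
def NatMatrix (p q n : ℕ) : Type :=
  {W : Matrix (Fin p) (Fin q) ℕ // ∑ i, ∑ j, W i j = n}

/-- The number of times that the column `(i, j)` occurs in `π`. -/
def GenPerm.mult {p q n : ℕ} (π : GenPerm p q n) (i : Fin p) (j : Fin q) : ℕ :=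
  (Finset.univ.filter fun k : Fin n => π.top k = i ∧ π.bot k = j).card

/-- The lengths of the weakly increasing subsequences of `π`; a subsequence is given by the set of
the positions `r₁ < … < r_m` that it occupies. -/
def GenPerm.increasingLengths {p q n : ℕ} (π : GenPerm p q n) : Set ℕ :=
  {m | ∃ S : Finset (Fin n), (∀ r ∈ S, ∀ s ∈ S, r ≤ s → π.bot r ≤ π.bot s) ∧ S.card = m}

/-- One step of a right/down path in a `p × q` array. -/
def PathStep {p q : ℕ} (a b : Fin p × Fin q) : Prop :=
  (b.1 = a.1 ∧ (b.2 : ℕ) = a.2 + 1) ∨ ((b.1 : ℕ) = a.1 + 1 ∧ b.2 = a.2)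

/-- The list `γ` of entries is a right/down path from the upper left corner to the lower right
corner of a `p × q` array. -/
def IsRightDownPath {p q : ℕ} (γ : List (Fin p × Fin q)) : Prop :=
  γ.IsChain PathStep ∧
    (∃ a ∈ γ.head?, (a.1 : ℕ) = 0 ∧ (a.2 : ℕ) = 0) ∧
    (∃ b ∈ γ.getLast?, (b.1 : ℕ) + 1 = p ∧ (b.2 : ℕ) + 1 = q)

/-- The weights `∑ w_{ij}` of the right/down paths from the upper left to the lower right corner. -/
def pathWeights {p q : ℕ} (W : Matrix (Fin p) (Fin q) ℕ) : Set ℕ :=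
  {w | ∃ γ : List (Fin p × Fin q), IsRightDownPath γ ∧ (γ.map fun c => W c.1 c.2).sum = w}

/-- Semistandard tableaux of shape `μ` with entries in the alphabet `[m]`. -/
def BoundedSSYT (m : ℕ) (μ : YoungDiagram) : Type :=
  {T : SemistandardYoungTableau μ // ∀ c ∈ μ.cells, T c.1 c.2 < m}

/-- The rows of a semistandard tableau, from top to bottom, each read from left to right. -/
def BoundedSSYT.rows {m : ℕ} {μ : YoungDiagram} (T : BoundedSSYT m μ) : List (List ℕ) :=
  (List.range (μ.colLen 0)).map fun i => (List.range (μ.rowLen i)).map fun j => T.1 i j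

instance (m : ℕ) (μ : YoungDiagram) : Finite (BoundedSSYT m μ) := by
  refine Finite.of_injective
    (fun (T : BoundedSSYT m μ) (c : μ.cells) => (⟨T.1 c.1.1 c.1.2, T.2 c.1 c.2⟩ : Fin m)) ?_
  intro T T' h
  apply Subtype.ext
  ext i j
  by_cases hc : (i, j) ∈ μ
  · have := congrArg Fin.val (congrFun h ⟨(i, j), hc⟩)
    simpa using this
  · rw [T.1.zeros hc, T'.1.zeros hc]

noncomputable instance (m : ℕ) (μ : YoungDiagram) : Fintype (BoundedSSYT m μ) :=
  Fintype.ofFinite _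

/-- Pairs `(P, Q)` of semistandard tableaux of the same shape `λ ⊢ n`, where `P` has entries in
`[a]` and `Q` has entries in `[b]`. -/
structure TableauPair (a b n : ℕ) where
  shape : YoungDiagram
  card_shape : shape.card = n
  P : BoundedSSYT a shape
  Q : BoundedSSYT b shape

/-- The Young diagrams of weight `n`, i.e. the partitions `λ ⊢ n`. -/
def Diagram (n : ℕ) : Type := {μ : YoungDiagram // μ.card = n}

instance (n : ℕ) : Finite (Diagram n) := by
  have key : ∀ μ : Diagram n, μ.1.cells ∈ (Finset.range n ×ˢ Finset.range n).powerset := by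
    rintro ⟨μ, rfl⟩
    rw [Finset.mem_powerset]
    rintro ⟨i, j⟩ hc
    have hsub : Finset.range (i + 1) ×ˢ Finset.range (j + 1) ⊆ μ.cells := by
      rintro ⟨a, b⟩ hab
      simp only [Finset.mem_product, Finset.mem_range] at hab
      exact μ.up_left_mem (by omega) (by omega) hc
    have hcard := Finset.card_le_card hsub
    rw [Finset.card_product, Finset.card_range, Finset.card_range] at hcard
    simp only [Finset.mem_product, Finset.mem_range]
    constructor <;> nlinarith
  refine Finite.of_injective
    (fun μ : Diagram n =>
      (⟨μ.1.cells, key μ⟩ : ((Finset.range n ×ˢ Finset.range n).powerset : Finset _))) ?_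
  intro μ ν h
  exact Subtype.ext (YoungDiagram.ext (congrArg Subtype.val h))

noncomputable instance (n : ℕ) : Fintype (Diagram n) := Fintype.ofFinite _

/-- The Schur polynomial `s̃_μ(x₁, …, x_m) = ∑_T ∏ᵢ xᵢ ^ #{times i appears in T}`. -/
noncomputable def schur (R : Type*) [CommSemiring R] (m : ℕ) (μ : YoungDiagram) :
    MvPolynomial (Fin m) R :=
  ∑ T : BoundedSSYT m μ, ∏ i : Fin m,
    MvPolynomial.X i ^ (μ.cells.filter fun c => T.1 c.1 c.2 = (i : ℕ)).card

/-- `s̃_μ(1^m)`, the value of the Schur polynomial at `x₁ = ⋯ = x_m = 1`. -/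
noncomputable def schurAtOnes (m : ℕ) (μ : YoungDiagram) : ℕ :=
  MvPolynomial.eval (fun _ => 1) (schur ℕ m μ)

/-- Row insertion of `x` into a weakly increasing row: if `x` is at least all the entries of the
row, `x` is put at its end and nothing is bumped; otherwise `x` replaces (the leftmost occurrence
of) the smallest entry `> x`, which is bumped. -/
def rowInsert (x : ℕ) : List ℕ → List ℕ × Option ℕ
  | [] => ([x], none)
  | y :: r => if y ≤ x then (y :: (rowInsert x r).1, (rowInsert x r).2) else (x :: r, some y)

/-- Insertion of `x` into a tableau (a list of rows), the bumped number being inserted into the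
next row. The second component is the index of the row in which the new box was created. -/
def insertion (x : ℕ) : List (List ℕ) → List (List ℕ) × ℕ
  | [] => ([[x]], 0)
  | r :: t =>
    match rowInsert x r with
    | (r', none) => (r' :: t, 0)
    | (r', some y) => (r' :: (insertion y t).1, (insertion y t).2 + 1)

/-- Add a box containing `x` at the end of row `k` of a tableau (as a new last row if there is no
row `k` yet). -/
def addBox (x : ℕ) : ℕ → List (List ℕ) → List (List ℕ)
  | _, [] => [[x]]
  | 0, r :: t => (r ++ [x]) :: t
  | k + 1, r :: t => r :: addBox x k t

/-- One step of the algorithm on `(P, Q)`: insert the bottom letter of the column `c` into `P`, and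
put its top letter into `Q` at the place of the new box of `P`. -/
def rskStep (PQ : List (List ℕ) × List (List ℕ)) (c : ℕ × ℕ) :
    List (List ℕ) × List (List ℕ) :=
  ((insertion c.2 PQ.1).1, addBox c.1 (insertion c.2 PQ.1).2 PQ.2)

/-- The Robinson-Schensted-Knuth algorithm: starting from the empty tableaux, process the columns
of `π` from left to right. The result is the list of rows of `P` and the list of rows of `Q`. -/
def rsk {p q n : ℕ} (π : GenPerm p q n) : List (List ℕ) × List (List ℕ) :=
  (List.ofFn fun k : Fin n => ((π.top k : ℕ), (π.bot k : ℕ))).foldl rskStep ([], [])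

end RSK

namespace RSK

/-! The bijection rests on the reversibility of insertion. An insertion can be undone once the row
of its new box is known: remove the last entry of that row and let each number pushed up replace the
last smaller entry of the row above (`insertion_injective`, `exists_insertion_eq`). `Q` tells which
box is the newest. If `j ≤ j'`, the box created by `j'` lies weakly above the one created by `j`
just before; if `j' < j`, it lies strictly below (`insertion_snd_le`, `insertion_snd_lt`). Hence,
while the top letter `i` stays the same, the boxes move weakly upwards, and the newest box is the
one holding the largest entry of `Q` in the topmost row where it occurs (`MaxAt`). This makes `Q`
semistandard, gives injectivity by peeling off the last column, and gives surjectivity because the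
strict statement forces the recovered columns to be in order.

Everything about rows is expressed by the counts `N(z)` of entries at most `z`. Inserting `x` turns
`N(z)` into `max (N(z)) (N(x) + 1)` for `z ≥ x` and leaves it unchanged otherwise
(`countP_le_rowInsert`). The greatest length of a weakly increasing subsequence with values at most
`z` obeys the same recursion when a letter `x` is appended, whence `L(π) = λ₁`. Finally, increasing
subsequences of `π` correspond to chains of matrix positions in the product order, and chains are
exactly the sets contained in a right/down path, whence `L(π) = L(W)`.

The columns of `π` are listed in lexicographic order, so `π` is the same as a multiset of `n` pairs,
i.e. a matrix of multiplicities. Stars and bars gives the binomial coefficient. -/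

/-! ### Row insertion. -/

theorem rowInsert_eq_of_forall_le {x : ℕ} {r : List ℕ} (h : ∀ e ∈ r, e ≤ x) :
    rowInsert x r = (r ++ [x], none) := by
  induction r with
  | nil => rfl
  | cons y r ih =>
    simp only [List.mem_cons, forall_eq_or_imp] at h
    simp [rowInsert, h.1, ih h.2]

theorem rowInsert_append_cons {x y : ℕ} {a b : List ℕ} (ha : ∀ e ∈ a, e ≤ x) (hxy : x < y) :
    rowInsert x (a ++ y :: b) = (a ++ x :: b, some y) := by
  induction a with
  | nil => simp [rowInsert, hxy]
  | cons z a ih =>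
    simp only [List.mem_cons, forall_eq_or_imp] at ha
    simp [rowInsert, ha.1, ih ha.2]

theorem rowInsert_cases (x : ℕ) (r : List ℕ) :
    ((∀ e ∈ r, e ≤ x) ∧ rowInsert x r = (r ++ [x], none)) ∨
      ∃ a y b, r = a ++ y :: b ∧ (∀ e ∈ a, e ≤ x) ∧ x < y ∧
        rowInsert x r = (a ++ x :: b, some y) := by
  induction r with
  | nil => exact Or.inl ⟨by simp, rfl⟩
  | cons z r ih =>
    by_cases hz : z ≤ x
    · rcases ih with ⟨h, -⟩ | ⟨a, y, b, rfl, ha, hxy, -⟩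
      · have h' : ∀ e ∈ z :: r, e ≤ x := by simpa [hz] using h
        exact Or.inl ⟨h', rowInsert_eq_of_forall_le h'⟩
      · have h' : ∀ e ∈ z :: a, e ≤ x := by simpa [hz] using ha
        exact Or.inr ⟨z :: a, y, b, rfl, h', hxy, rowInsert_append_cons (a := z :: a) h' hxy⟩
    · exact Or.inr ⟨[], z, r, rfl, by simp, by omega, by simp [rowInsert, hz]⟩

theorem pairwise_rowInsert {x : ℕ} {r : List ℕ} (hr : r.Pairwise (· ≤ ·)) :
    (rowInsert x r).1.Pairwise (· ≤ ·) := by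
  rcases rowInsert_cases x r with ⟨h, e⟩ | ⟨a, y, b, rfl, ha, hxy, e⟩
  · rw [e]
    simpa [List.pairwise_append, hr] using h
  · rw [e]
    simp only [List.pairwise_append, List.pairwise_cons, List.mem_cons] at hr ⊢
    obtain ⟨h1, ⟨h2, h3⟩, h4⟩ := hr
    refine ⟨h1, ⟨fun b hb => by have := h2 b hb; omega, h3⟩, ?_⟩
    rintro u hu v (rfl | hv)
    · exact ha u hu
    · exact h4 u hu v (Or.inr hv)

/-- The effect of row insertion on the number of entries that are at most `z`. -/
theorem countP_le_rowInsert {x : ℕ} {r : List ℕ} (hr : r.Pairwise (· ≤ ·)) (z : ℕ) :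
    (rowInsert x r).1.countP (· ≤ z) =
      if x ≤ z then max (r.countP (· ≤ z)) (r.countP (· ≤ x) + 1) else r.countP (· ≤ z) := by
  rcases rowInsert_cases x r with ⟨h, e⟩ | ⟨a, y, b, rfl, ha, hxy, e⟩
  · rw [e]
    split_ifs with hz
    · have h1 : r.countP (· ≤ z) = r.length :=
        List.countP_eq_length.2 fun e he => by simpa using (h e he).trans hz
      have h2 : r.countP (· ≤ x) = r.length := List.countP_eq_length.2 (by simpa using h)
      simp [List.countP_append, hz, h1, h2]
    · simp [List.countP_append, hz]
  · rw [e]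
    simp only [List.pairwise_append, List.pairwise_cons, List.mem_cons] at hr
    obtain ⟨-, ⟨h2, -⟩, -⟩ := hr
    have hb : ∀ w < y, b.countP (· ≤ w) = 0 := fun w hw =>
      List.countP_eq_zero.2 fun e he => by have := h2 e he; simp; omega
    have haz : ∀ w, x ≤ w → a.countP (· ≤ w) = a.length := fun w hw =>
      List.countP_eq_length.2 fun e he => by simpa using (ha e he).trans hw
    have hyx : ¬ y ≤ x := by omega
    simp only [List.countP_append, List.countP_cons, decide_eq_true_eq, hyx, if_false]
    have h1 := haz x le_rfl
    have h2 := hb x hxy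
    by_cases hz : x ≤ z
    · have h3 := haz z hz
      by_cases hyz : y ≤ z
      · simp only [hz, hyz, if_true]
        omega
      · have h4 := hb z (by omega)
        simp only [hz, hyz, if_true, if_false]
        omega
    · have hyz : ¬ y ≤ z := by omega
      simp [hz, hyz]

/-! ### Strict columns, and insertion into a tableau. -/

/-- `Dominates r s` says that the row `s` can stand below the row `r` in a semistandard tableau. -/
def Dominates (r s : List ℕ) : Prop :=
  ∀ z, s.countP (· ≤ z) ≤ r.countP (· < z)

theorem dominates_nil (r : List ℕ) : Dominates r [] := fun _ => by simp

theorem countP_lt_lt_countP_lt {r : List ℕ} {y z : ℕ} (hy : y ∈ r) (hz : y < z) :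
    r.countP (· < y) < r.countP (· < z) := by
  obtain ⟨a, b, rfl⟩ := List.append_of_mem hy
  have h : ∀ l : List ℕ, l.countP (· < y) ≤ l.countP (· < z) := fun l =>
    List.countP_mono_left fun e _ he => by simp at he ⊢; omega
  have := h a
  have := h b
  simp only [List.countP_append, List.countP_cons, decide_eq_true_eq, hz, if_true, lt_irrefl,
    if_false]
  omega

theorem Dominates.length_le {r s : List ℕ} (h : Dominates r s) : s.length ≤ r.length := by
  -- The sum of `s` bounds each of its entries, so at this threshold all of `s` is counted.
  have h1 := h s.sum
  rw [List.countP_eq_length.2 fun e he => by simpa using List.le_sum_of_mem he] at h1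
  exact h1.trans List.countP_le_length

theorem Dominates.append {r s : List ℕ} (h : Dominates r s) (t : List ℕ) :
    Dominates (r ++ t) s := fun z => by
  have := h z
  simp only [List.countP_append]
  omega

/-- A bumping step keeps the columns strictly increasing. -/
theorem Dominates.rowInsert {x y : ℕ} {a b s : List ℕ} (hs : s.Pairwise (· ≤ ·))
    (hxy : x < y) (h : Dominates (a ++ y :: b) s) :
    Dominates (a ++ x :: b) (rowInsert y s).1 := fun z => by
  have hz := h z
  have hy := h y
  rw [countP_le_rowInsert hs]
  have hlt : y < z → (a ++ y :: b).countP (· < y) < (a ++ y :: b).countP (· < z) :=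
    countP_lt_lt_countP_lt (by simp)
  simp only [List.countP_append, List.countP_cons, decide_eq_true_eq] at hz hy hlt ⊢
  -- Below `y` the count of `s` is unchanged; at `z = y` it grows by one, matched by the new `x < y`
  -- in the upper row. Above `y` the upper count is unchanged, and the only new bound needed, on the
  -- count of `s` at `y` plus one, holds because `y` itself contributes to the upper count at `z`
  -- but not at `y`.
  rcases lt_trichotomy z y with hzy | rfl | hzy
  · split_ifs at * <;> omega
  · split_ifs at * <;> omega
  · have := hlt hzy
    split_ifs at * <;> omega

/-- A list of rows that form a semistandard tableau. -/
def IsTableau : List (List ℕ) → Prop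
  | [] => True
  | r :: t => r ≠ [] ∧ r.Pairwise (· ≤ ·) ∧ Dominates r (t.headD []) ∧ IsTableau t

theorem IsTableau.pairwise_headD {T : List (List ℕ)} (h : IsTableau T) :
    (T.headD []).Pairwise (· ≤ ·) := by
  cases T with
  | nil => simp
  | cons r t => exact h.2.1

theorem IsTableau.ne_nil {T : List (List ℕ)} (h : IsTableau T) : ∀ r ∈ T, r ≠ [] := by
  induction T with
  | nil => simp
  | cons r t ih => simpa using ⟨h.1, ih h.2.2.2⟩

theorem insertion_cons_none {x : ℕ} {r s : List ℕ} {t : List (List ℕ)}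
    (h : rowInsert x r = (s, none)) : insertion x (r :: t) = (s :: t, 0) := by
  simp [insertion, h]

theorem insertion_cons_some {x y : ℕ} {r s : List ℕ} {t : List (List ℕ)}
    (h : rowInsert x r = (s, some y)) :
    insertion x (r :: t) = (s :: (insertion y t).1, (insertion y t).2 + 1) := by
  simp [insertion, h]

theorem headD_insertion (x : ℕ) (T : List (List ℕ)) :
    (insertion x T).1.headD [] = (rowInsert x (T.headD [])).1 := by
  cases T with
  | nil => rfl
  | cons r t =>
    rcases rowInsert_cases x r with ⟨-, e⟩ | ⟨a, y, b, rfl, -, -, e⟩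
    · rw [insertion_cons_none e]; simp [e]
    · rw [insertion_cons_some e]; simp [e]

theorem isTableau_insertion {x : ℕ} {T : List (List ℕ)} (hT : IsTableau T) :
    IsTableau (insertion x T).1 := by
  induction T generalizing x with
  | nil => simp [insertion, IsTableau, dominates_nil]
  | cons r t ih =>
    obtain ⟨h1, h2, h3, h4⟩ := hT
    have hs := pairwise_rowInsert (x := x) h2
    rcases rowInsert_cases x r with ⟨-, e⟩ | ⟨a, y, b, rfl, -, hxy, e⟩
    · rw [insertion_cons_none e]
      rw [e] at hs
      exact ⟨by simp, hs, h3.append _, h4⟩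
    · rw [insertion_cons_some e]
      rw [e] at hs
      refine ⟨by simp, hs, ?_, ih h4⟩
      rw [headD_insertion]
      exact h3.rowInsert h4.pairwise_headD hxy

theorem flatten_insertion_perm (x : ℕ) (T : List (List ℕ)) :
    (insertion x T).1.flatten.Perm (x :: T.flatten) := by
  induction T generalizing x with
  | nil => simp [insertion]
  | cons r t ih =>
    rcases rowInsert_cases x r with ⟨-, e⟩ | ⟨a, y, b, rfl, -, -, e⟩
    · rw [insertion_cons_none e]
      simp
    · rw [insertion_cons_some e]
      have := ih y
      rw [← Multiset.coe_eq_coe] at this ⊢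
      simp only [List.flatten_cons, ← Multiset.coe_add, ← Multiset.cons_coe, this] at this ⊢
      simp only [← Multiset.singleton_add]
      abel

/-- The lengths of the rows after adding a box at the end of row `k`. -/
def incrRow : ℕ → List ℕ → List ℕ
  | _, [] => [1]
  | 0, a :: l => (a + 1) :: l
  | k + 1, a :: l => a :: incrRow k l

theorem map_length_insertion (x : ℕ) (T : List (List ℕ)) :
    (insertion x T).1.map List.length = incrRow (insertion x T).2 (T.map List.length) := by
  induction T generalizing x with
  | nil => simp [insertion, incrRow]
  | cons r t ih =>
    rcases rowInsert_cases x r with ⟨-, e⟩ | ⟨a, y, b, rfl, -, -, e⟩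
    · rw [insertion_cons_none e]; simp [incrRow]
    · rw [insertion_cons_some e]; simp [incrRow, ih]

theorem map_length_addBox (i k : ℕ) (T : List (List ℕ)) :
    (addBox i k T).map List.length = incrRow k (T.map List.length) := by
  induction T generalizing k with
  | nil => cases k <;> simp [addBox, incrRow]
  | cons r t ih => cases k <;> simp [addBox, incrRow, ih]

/-- Zero lengths must be excluded: `[]` and `[0]` both become `[1]`. -/
theorem incrRow_injective {k : ℕ} {l l' : List ℕ} (hl : 0 ∉ l) (hl' : 0 ∉ l')
    (h : incrRow k l = incrRow k l') : l = l' := by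
  induction l generalizing k l' with
  | nil =>
    cases l' with
    | nil => rfl
    | cons a l' =>
      cases k with
      | zero => simp_all [incrRow]
      | succ k => cases l' <;> cases k <;> simp_all [incrRow]
  | cons a l ih =>
    cases l' with
    | nil =>
      cases k with
      | zero => simp_all [incrRow]
      | succ k => cases l <;> cases k <;> simp_all [incrRow]
    | cons b l' =>
      cases k with
      | zero => simp_all [incrRow]
      | succ k =>
        simp only [incrRow, List.cons.injEq, List.mem_cons, not_or] at h hl hl'
        rw [h.1, ih hl.2 hl'.2 h.2]

/-! ### Successive bumping routes. -/

/-- After `x` has replaced `y`, a number `x' ≥ x` can only bump some `y'` to the right of that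
place, so `y ≤ y'` and the situation repeats in the next row. The second route therefore stops no
later than the first. -/
theorem insertion_snd_le {x x' : ℕ} (hx : x ≤ x') {T : List (List ℕ)} (hT : IsTableau T) :
    (insertion x' (insertion x T).1).2 ≤ (insertion x T).2 := by
  induction T generalizing x x' with
  | nil => simp [insertion, rowInsert, hx]
  | cons r t ih =>
    obtain ⟨-, hr, -, ht⟩ := hT
    rcases rowInsert_cases x r with ⟨h, e⟩ | ⟨a, y, b, rfl, ha, hxy, e⟩
    · rw [insertion_cons_none e, insertion_cons_none (rowInsert_eq_of_forall_le ?_)]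
      simp only [List.mem_append, List.mem_singleton]
      rintro e (he | rfl)
      · exact (h e he).trans hx
      · exact hx
    · rw [insertion_cons_some e]
      have hax : ∀ c : List ℕ, (∀ e ∈ c, e ≤ x') → ∀ e ∈ a ++ x :: c, e ≤ x' := by
        intro c hc e he
        simp only [List.mem_append, List.mem_cons] at he
        rcases he with he | rfl | he
        · exact (ha e he).trans hx
        · exact hx
        · exact hc e he
      rcases rowInsert_cases x' b with ⟨h, -⟩ | ⟨c, y', d, rfl, hc, hxy', -⟩
      · rw [insertion_cons_none (rowInsert_eq_of_forall_le (hax b h))]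
        exact Nat.zero_le _
      · have h := rowInsert_append_cons (b := d) (hax c hc) hxy'
        rw [List.append_assoc, List.cons_append] at h
        rw [insertion_cons_some h]
        have hy : y ≤ y' := by
          simp only [List.pairwise_append, List.pairwise_cons] at hr
          exact hr.2.1.1 y' (by simp)
        exact Nat.succ_le_succ (ih hy ht)

/-- Since `x` is now in the row, `x' < x` certainly bumps something: `x` itself or an entry to its
left. The bumped number is at most `x`, hence smaller than the `y` that `x` bumped, and the
situation repeats in the next row. -/
theorem insertion_snd_lt {x x' : ℕ} (hx : x' < x) {T : List (List ℕ)} (hT : IsTableau T) :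
    (insertion x T).2 < (insertion x' (insertion x T).1).2 := by
  induction T generalizing x x' with
  | nil =>
    have : ¬ x ≤ x' := by omega
    simp [insertion, rowInsert, this]
  | cons r t ih =>
    obtain ⟨-, hr, -, ht⟩ := hT
    rcases rowInsert_cases x r with ⟨h, e⟩ | ⟨a, y, b, rfl, ha, hxy, e⟩
    · rw [insertion_cons_none e]
      rcases rowInsert_cases x' (r ++ [x]) with ⟨h, -⟩ | ⟨c, y', d, -, -, -, e'⟩
      · have := h x (by simp)
        omega
      · rw [insertion_cons_some e']
        exact Nat.succ_pos _
    · rw [insertion_cons_some e]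
      rcases rowInsert_cases x' a with ⟨h, -⟩ | ⟨c, y', d, rfl, hc, hxy', -⟩
      · rw [insertion_cons_some (rowInsert_append_cons h hx)]
        exact Nat.succ_lt_succ (ih hxy ht)
      · have h := rowInsert_append_cons (b := d ++ x :: b) hc hxy'
        rw [← List.cons_append, ← List.append_assoc] at h
        rw [insertion_cons_some h]
        exact Nat.succ_lt_succ (ih ((ha y' (by simp)).trans_lt hxy) ht)

/-! ### Reverse insertion. -/

/-- A list splits in at most one way before the last entry satisfying `P`. -/
theorem eq_of_append_cons_eq_append_cons {α : Type*} (P : α → Prop) {a b a' b' : List α}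
    {x x' : α} (hx : P x) (hb : ∀ e ∈ b, ¬ P e) (hx' : P x') (hb' : ∀ e ∈ b', ¬ P e)
    (h : a ++ x :: b = a' ++ x' :: b') : a = a' ∧ x = x' ∧ b = b' := by
  induction a generalizing a' with
  | nil =>
    cases a' with
    | nil => simpa using h
    | cons z a' =>
      simp only [List.nil_append, List.cons_append, List.cons.injEq] at h
      exact absurd hx' (hb x' (by simp [h.2]))
  | cons z a ih =>
    cases a' with
    | nil =>
      simp only [List.nil_append, List.cons_append, List.cons.injEq] at h
      exact absurd hx (hb' x (by simp [← h.2]))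
    | cons z' a' =>
      simp only [List.cons_append, List.cons.injEq] at h
      simpa [h.1] using ih h.2

/-- By induction the rows below determine the number `y` bumped into them. As the old row was sorted
with `y` at the place now held by `x`, everything after `x` is at least `y`; so `x` is recovered as
the last entry smaller than `y`. -/
theorem insertion_injective {x x' : ℕ} {T T' : List (List ℕ)} (hT : IsTableau T)
    (hT' : IsTableau T') (h : insertion x T = insertion x' T') : x = x' ∧ T = T' := by
  induction T generalizing x x' T' with
  | nil =>
    cases T' with
    | nil => simpa [insertion] using h
    | cons r t =>
      have hr := hT'.1
      rcases rowInsert_cases x' r with ⟨-, e⟩ | ⟨a, y, b, rfl, -, -, e⟩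
      · rw [insertion_cons_none e] at h
        simp only [insertion, Prod.mk.injEq, List.cons.injEq] at h
        have := congrArg List.length h.1.1
        have := List.length_pos_iff.2 hr
        simp only [List.length_append, List.length_singleton] at *
        omega
      · rw [insertion_cons_some e] at h
        simp [insertion] at h
  | cons r t ih =>
    obtain ⟨h1, h2, -, h4⟩ := hT
    cases T' with
    | nil =>
      rcases rowInsert_cases x r with ⟨-, e⟩ | ⟨a, y, b, rfl, -, -, e⟩
      · rw [insertion_cons_none e] at h
        simp only [insertion, Prod.mk.injEq, List.cons.injEq] at h
        have := congrArg List.length h.1.1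
        have := List.length_pos_iff.2 h1
        simp only [List.length_append, List.length_singleton] at *
        omega
      · rw [insertion_cons_some e] at h
        simp [insertion] at h
    | cons r' t' =>
      obtain ⟨h1', h2', -, h4'⟩ := hT'
      rcases rowInsert_cases x r with ⟨-, e⟩ | ⟨a, y, b, rfl, ha, hxy, e⟩ <;>
      rcases rowInsert_cases x' r' with ⟨-, e'⟩ | ⟨a', y', b', rfl, ha', hxy', e'⟩
      · rw [insertion_cons_none e, insertion_cons_none e'] at h
        simp only [Prod.mk.injEq, List.cons.injEq, and_true] at h
        have := List.append_inj' h.1 rfl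
        simp_all
      · rw [insertion_cons_none e, insertion_cons_some e'] at h
        simp at h
      · rw [insertion_cons_some e, insertion_cons_none e'] at h
        simp at h
      · rw [insertion_cons_some e, insertion_cons_some e'] at h
        simp only [Prod.mk.injEq, List.cons.injEq, add_left_inj] at h
        obtain ⟨rfl, rfl⟩ := ih h4 h4' (Prod.ext h.1.2 h.2)
        simp only [List.pairwise_append, List.pairwise_cons] at h2 h2'
        obtain ⟨rfl, rfl, rfl⟩ := eq_of_append_cons_eq_append_cons (· < y) hxy
          (fun e he => by have := h2.2.1.1 e he; omega) hxy'
          (fun e he => by have := h2'.2.1.1 e he; omega) h.1.1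
        exact ⟨rfl, rfl⟩

/-- `IsCorner k l` says that a Young diagram with row lengths `l` has a removable box in
row `k`. -/
def IsCorner : ℕ → List ℕ → Prop
  | _, [] => False
  | 0, a :: l => l.headD 0 < a
  | k + 1, _ :: l => IsCorner k l

theorem exists_eq_append_cons_of_exists {α : Type*} (P : α → Prop) [DecidablePred P] {l : List α}
    (h : ∃ x ∈ l, P x) : ∃ a x b, l = a ++ x :: b ∧ P x ∧ ∀ e ∈ b, ¬ P e := by
  induction l with
  | nil => simp at h
  | cons z l ih =>
    by_cases hl : ∃ x ∈ l, P x
    · obtain ⟨a, x, b, rfl, hx, hb⟩ := ih hl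
      exact ⟨z :: a, x, b, rfl, hx, hb⟩
    · push Not at hl
      refine ⟨[], z, l, rfl, ?_, hl⟩
      obtain ⟨x, hx, hPx⟩ := h
      rcases List.mem_cons.1 hx with rfl | hx
      · exact hPx
      · exact absurd hPx (hl x hx)

theorem headD_map_length (T : List (List ℕ)) :
    (T.map List.length).headD 0 = (T.headD []).length := by
  cases T <;> rfl

/-- Reverse bumping. In the corner row the last entry is removed, which keeps the columns strict
because the next row is shorter. Higher up, the number `y` coming from below replaces the last entry
`x < y`, and `x` is passed on. -/
theorem exists_insertion_eq {k : ℕ} {P : List (List ℕ)} (hP : IsTableau P)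
    (hk : IsCorner k (P.map List.length)) :
    ∃ x T, IsTableau T ∧ insertion x T = (P, k) := by
  induction k generalizing P with
  | zero =>
    cases P with
    | nil => exact hk.elim
    | cons r t =>
      obtain ⟨h1, h2, h3, h4⟩ := hP
      rw [List.map_cons, IsCorner, headD_map_length] at hk
      obtain ⟨r, x, rfl⟩ := (List.eq_nil_or_concat' r).resolve_left h1
      simp only [List.pairwise_append, List.mem_singleton, forall_eq] at h2
      rcases eq_or_ne r [] with rfl | hr
      · refine ⟨x, [], trivial, ?_⟩
        cases t with
        | nil => rfl
        | cons s t =>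
          exact absurd (by simpa using hk) h4.1
      · refine ⟨x, r :: t, ⟨hr, h2.1, fun z => ?_, h4⟩,
          insertion_cons_none (rowInsert_eq_of_forall_le h2.2.2)⟩
        have hz := h3 z
        simp only [List.countP_append, List.countP_singleton, decide_eq_true_eq] at hz
        split_ifs at hz with hxz
        · have : r.countP (· < z) = r.length :=
            List.countP_eq_length.2 fun e he => by simpa using (h2.2.2 e he).trans_lt hxz
          rw [this]
          simp only [List.length_append, List.length_singleton] at hk
          have : (t.headD []).countP (· ≤ z) ≤ _ := List.countP_le_length
          omega
        · exact hz
  | succ k ih =>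
    cases P with
    | nil => exact hk.elim
    | cons s t =>
      obtain ⟨h1, h2, h3, h4⟩ := hP
      obtain ⟨y, T, hT, he⟩ := ih h4 hk
      have hhead := headD_insertion y T
      rw [he] at hhead
      simp only at hhead
      rw [hhead] at h3
      have hw := hT.pairwise_headD
      set w := T.headD []
      have hcount : ∀ z, _ := fun z => countP_le_rowInsert (x := y) hw z
      -- The row below contains `y`, so strict columns force an entry smaller than `y` in `s`.
      have hpos : 0 < s.countP (· < y) := by
        have := hcount y
        have := h3 y
        simp only [le_refl, if_true] at *
        omega
      simp only [List.countP_pos_iff, decide_eq_true_eq] at hpos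
      obtain ⟨a, x, b, rfl, hxy, hb⟩ := exists_eq_append_cons_of_exists (· < y) hpos
      simp only [List.pairwise_append, List.pairwise_cons, List.mem_cons] at h2
      obtain ⟨h5, ⟨h6, h7⟩, h8⟩ := h2
      have hax : ∀ e ∈ a, e ≤ x := fun e he => h8 e he x (Or.inl rfl)
      refine ⟨x, (a ++ y :: b) :: T, ⟨by simp, ?_, fun z => ?_, hT⟩, ?_⟩
      · simp only [List.pairwise_append, List.pairwise_cons, List.mem_cons]
        refine ⟨h5, ⟨fun e he => not_lt.1 (hb e he), h7⟩, ?_⟩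
        rintro u hu v (rfl | hv)
        · exact (hax u hu).trans hxy.le
        · exact h8 u hu v (Or.inr hv)
      · change w.countP (· ≤ z) ≤ _
        have hz := h3 z
        have hy := h3 y
        rw [hcount] at hz hy
        have hbc : ∀ z ≤ y, b.countP (· < z) = 0 := fun z hz =>
          List.countP_eq_zero.2 fun e he => by have := hb e he; simp; omega
        have hac : ∀ z, x < z → a.countP (· < z) = a.length := fun z hz =>
          List.countP_eq_length.2 fun e he => by simpa using (hax e he).trans_lt hz
        simp only [List.countP_append, List.countP_cons, decide_eq_true_eq, le_refl, if_true,
          hxy, hbc y le_rfl, hac y hxy] at hz hy ⊢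
        -- For `z > y` or `z ≤ x`, exchanging `x` for `y` does not affect the number of entries
        -- below `z`. For `x < z ≤ y` the exchange costs one, but this is repaid by `hy`: undoing
        -- the insertion of `y` into `w` leaves at most `a.length` entries that are at most `y`.
        rcases lt_or_ge y z with hyz | hyz
        · have hxz : x < z := hxy.trans hyz
          simp only [hyz, hyz.le, hxz, if_true] at hz ⊢
          omega
        · have hmono : w.countP (· ≤ z) ≤ w.countP (· ≤ y) :=
            List.countP_mono_left fun e _ he => by simp at he ⊢; omega
          have hyz' : ¬ y < z := by omega
          rcases lt_or_ge x z with hxz | hxz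
          · rw [hac z hxz, hbc z hyz]
            simp only [hyz', if_false]
            omega
          · have h1 : ¬ x < z := by omega
            have h2 : ¬ y ≤ z := by omega
            simpa only [hyz', h1, h2, if_false] using hz
      · rw [insertion_cons_some (rowInsert_append_cons hax hxy), he]

/-! ### The recording tableau: adding and removing its newest box. -/

/-- `BoxFits i k Q` says that a box with entry `i` at the end of row `k` is at least all entries
of `Q` and larger than all entries of the rows above row `k`. -/
def BoxFits (i k : ℕ) (Q : List (List ℕ)) : Prop :=
  (∀ r ∈ Q, ∀ e ∈ r, e ≤ i) ∧ ∀ r ∈ Q.take k, ∀ e ∈ r, e < i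

/-- `MaxAt i k Q` says that `i` is the largest entry of `Q`, and that row `k` is the topmost row
containing it. -/
def MaxAt (i k : ℕ) (Q : List (List ℕ)) : Prop :=
  BoxFits i k Q ∧ ∃ r, Q[k]? = some (r ++ [i])

theorem boxFits_succ_cons {i k : ℕ} {r : List ℕ} {Q : List (List ℕ)} :
    BoxFits i (k + 1) (r :: Q) ↔ (∀ e ∈ r, e < i) ∧ BoxFits i k Q := by
  simp only [BoxFits, List.take_succ_cons, List.forall_mem_cons]
  constructor
  · tauto
  · rintro ⟨h1, h2, h3⟩
    exact ⟨⟨fun e he => (h1 e he).le, h2⟩, h1, h3⟩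

theorem maxAt_succ_cons {i k : ℕ} {r : List ℕ} {Q : List (List ℕ)} :
    MaxAt i (k + 1) (r :: Q) ↔ (∀ e ∈ r, e < i) ∧ MaxAt i k Q := by
  simp only [MaxAt, boxFits_succ_cons, List.getElem?_cons_succ, and_assoc]

theorem addBox_zero_cons (i : ℕ) (r : List ℕ) (t : List (List ℕ)) :
    addBox i 0 (r :: t) = (r ++ [i]) :: t := rfl

theorem addBox_nil (i k : ℕ) : addBox i k [] = [[i]] := by cases k <;> rfl

theorem addBox_succ_cons (i k : ℕ) (r : List ℕ) (t : List (List ℕ)) :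
    addBox i (k + 1) (r :: t) = r :: addBox i k t := rfl

theorem flatten_addBox_perm (i k : ℕ) (Q : List (List ℕ)) :
    (addBox i k Q).flatten.Perm (i :: Q.flatten) := by
  induction Q generalizing k with
  | nil => simp [addBox_nil]
  | cons r t ih =>
    cases k with
    | zero => simp [addBox_zero_cons]
    | succ k =>
      rw [addBox_succ_cons, List.flatten_cons, List.flatten_cons]
      exact ((ih k).append_left r).trans List.perm_middle

theorem maxAt_addBox {i k : ℕ} {Q : List (List ℕ)} (hk : k ≤ Q.length) (h : BoxFits i k Q) :
    MaxAt i k (addBox i k Q) := by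
  induction Q generalizing k with
  | nil =>
    obtain rfl : k = 0 := by simpa using hk
    exact ⟨by simp [BoxFits, addBox_nil], [], by simp [addBox_nil]⟩
  | cons r t ih =>
    cases k with
    | zero =>
      refine ⟨⟨?_, by simp⟩, r, by simp [addBox_zero_cons]⟩
      have := h.1
      simp only [List.forall_mem_cons] at this
      simp only [addBox_zero_cons, List.forall_mem_cons, List.mem_append, List.mem_singleton]
      refine ⟨?_, this.2⟩
      rintro e (he | rfl)
      · exact this.1 e he
      · exact le_rfl
    | succ k =>
      rw [addBox_succ_cons, maxAt_succ_cons]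
      rw [boxFits_succ_cons] at h
      exact ⟨h.1, ih (by simpa using hk) h.2⟩

theorem MaxAt.mem_flatten {i k : ℕ} {Q : List (List ℕ)} (h : MaxAt i k Q) : i ∈ Q.flatten := by
  obtain ⟨r, hr⟩ := h.2
  exact List.mem_flatten.2 ⟨_, List.mem_of_getElem? hr, by simp⟩

theorem MaxAt.le_of_mem {i k : ℕ} {Q : List (List ℕ)} (h : MaxAt i k Q) :
    ∀ e ∈ Q.flatten, e ≤ i := by
  intro e he
  obtain ⟨r, hr, he⟩ := List.mem_flatten.1 he
  exact h.1.1 r hr e he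

theorem MaxAt.le_of_boxFits {i k k' : ℕ} {Q : List (List ℕ)} (h : MaxAt i k Q)
    (h' : BoxFits i k' Q) : k' ≤ k := by
  by_contra! hk
  obtain ⟨r, hr⟩ := h.2
  have : r ++ [i] ∈ Q.take k' :=
    List.mem_of_getElem? (i := k) (by rw [List.getElem?_take_of_lt hk, hr])
  exact lt_irrefl i (h'.2 _ this i (by simp))

theorem MaxAt.unique {i i' k k' : ℕ} {Q : List (List ℕ)} (h : MaxAt i k Q) (h' : MaxAt i' k' Q) :
    i = i' ∧ k = k' := by
  obtain rfl : i = i' := le_antisymm (h'.le_of_mem i h.mem_flatten) (h.le_of_mem i' h'.mem_flatten)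
  exact ⟨rfl, le_antisymm (h'.le_of_boxFits h.1) (h.le_of_boxFits h'.1)⟩

theorem exists_maxAt {Q : List (List ℕ)} (hQ : IsTableau Q) (hne : Q ≠ []) : ∃ i k, MaxAt i k Q := by
  induction Q with
  | nil => exact absurd rfl hne
  | cons r t ih =>
    obtain ⟨h1, h2, -, h4⟩ := hQ
    obtain ⟨r, x, rfl⟩ := (List.eq_nil_or_concat' r).resolve_left h1
    have hr : ∀ e ∈ r ++ [x], e ≤ x := by
      simp only [List.pairwise_append, List.mem_singleton, forall_eq] at h2
      simp only [List.mem_append, List.mem_singleton]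
      rintro e (he | rfl)
      · exact h2.2.2 e he
      · exact le_rfl
    by_cases ht : ∀ s ∈ t, ∀ e ∈ s, e ≤ x
    · exact ⟨x, 0, ⟨by simpa only [List.forall_mem_cons] using ⟨hr, ht⟩, by simp⟩, r, rfl⟩
    · have htne : t ≠ [] := by rintro rfl; simp at ht
      obtain ⟨i, k, h⟩ := ih h4 htne
      push Not at ht
      obtain ⟨s, hs, e, he, hxe⟩ := ht
      have hei := h.le_of_mem e (List.mem_flatten.2 ⟨s, hs, he⟩)
      exact ⟨i, k + 1, maxAt_succ_cons.2 ⟨fun e' he' => (hr e' he').trans_lt (by omega), h⟩⟩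

theorem IsTableau.headD_length_le {r : List ℕ} {t : List (List ℕ)} (h : IsTableau (r :: t)) :
    (t.headD []).length ≤ r.length :=
  h.2.2.1.length_le

/-- `P` only guarantees that the new shape is a Young diagram. Strict columns then follow: the row
above the new box has all entries smaller than `i`, so at thresholds `z ≥ i` comparing lengths is
enough. -/
theorem isTableau_addBox {i k : ℕ} {Q P : List (List ℕ)} (hQ : IsTableau Q) (h : BoxFits i k Q)
    (hP : IsTableau P) (hPQ : P.map List.length = (addBox i k Q).map List.length) :
    IsTableau (addBox i k Q) := by
  induction Q generalizing k P with
  | nil => simp [addBox_nil, IsTableau, dominates_nil]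
  | cons r t ih =>
    obtain ⟨h1, h2, h3, h4⟩ := hQ
    cases k with
    | zero =>
      refine ⟨by simp, ?_, h3.append _, h4⟩
      simpa [List.pairwise_append, h2] using h.1 r (by simp)
    | succ k =>
      rw [addBox_succ_cons] at hPQ ⊢
      rw [boxFits_succ_cons] at h
      cases P with
      | nil => simp at hPQ
      | cons s P =>
        simp only [List.map_cons, List.cons.injEq] at hPQ
        refine ⟨h1, h2, fun z => ?_, ih h4 h.2 hP.2.2.2 hPQ.2⟩
        have hlen := hP.headD_length_le
        rw [← headD_map_length, hPQ.1, hPQ.2, headD_map_length] at hlen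
        have key : ∀ w : List ℕ, Dominates r w → (w ++ [i]).length ≤ r.length →
            (w ++ [i]).countP (· ≤ z) ≤ r.countP (· < z) := by
          intro w hw hlen
          rcases le_or_gt i z with hz | hz
          · have : r.countP (· < z) = r.length :=
              List.countP_eq_length.2 fun e he => by simpa using (h.1 e he).trans_le hz
            rw [this]
            exact List.countP_le_length.trans hlen
          · have := hw z
            simpa [List.countP_append, hz] using this
        cases t with
        | nil =>
          rw [addBox_nil] at hlen ⊢
          exact key [] (dominates_nil r) hlen
        | cons u t =>
          cases k with
          | zero => exact key u h3 hlen
          | succ k => exact h3 z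

theorem addBox_injective {i k : ℕ} {Q Q' : List (List ℕ)} (hQ : IsTableau Q) (hQ' : IsTableau Q')
    (h : addBox i k Q = addBox i k Q') : Q = Q' := by
  have hnil : ∀ {k : ℕ} {r : List ℕ} {t : List (List ℕ)}, r ≠ [] →
      addBox i k (r :: t) ≠ [[i]] := by
    intro k r t hr h
    cases k with
    | zero => simp_all [addBox_zero_cons]
    | succ k =>
      have := congrArg List.length (List.cons.inj h).2
      cases t <;> cases k <;> simp [addBox] at this
  induction Q generalizing k Q' with
  | nil =>
    cases Q' with
    | nil => rfl
    | cons r t => exact absurd (h.symm.trans (addBox_nil i k)) (hnil hQ'.1)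
  | cons r t ih =>
    cases Q' with
    | nil => exact absurd (h.trans (addBox_nil i k)) (hnil hQ.1)
    | cons r' t' =>
      cases k with
      | zero => simpa [addBox_zero_cons] using h
      | succ k =>
        simp only [addBox_succ_cons, List.cons.injEq] at h
        rw [h.1, ih hQ.2.2.2 hQ'.2.2.2 h.2]

/-- The box is a corner because all entries of the next row are at most `i`: domination at the
threshold `i` bounds the length of that row by the number of entries smaller than `i` in row `k`,
which does not count the final `i`. The same bound keeps the columns strict after removal. -/
theorem exists_addBox_eq {i k : ℕ} {Q : List (List ℕ)} (hQ : IsTableau Q) (h : MaxAt i k Q) :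
    IsCorner k (Q.map List.length) ∧ ∃ Q', IsTableau Q' ∧ BoxFits i k Q' ∧ addBox i k Q' = Q := by
  induction Q generalizing k with
  | nil => simpa using h.2
  | cons r t ih =>
    have hQ' := hQ
    obtain ⟨h1, h2, h3, h4⟩ := hQ
    cases k with
    | zero =>
      obtain ⟨⟨hle, -⟩, r', hr⟩ := h
      simp only [List.getElem?_cons_zero, Option.some.injEq] at hr
      subst hr
      simp only [List.forall_mem_cons] at hle
      have hlt : ∀ w : List ℕ, (∀ e ∈ w, e ≤ i) → Dominates (r' ++ [i]) w → Dominates r' w := by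
        intro w hw hd z
        have h5 := hd z
        have h6 := hd i
        rw [List.countP_eq_length.2 (by simpa using hw)] at h6
        simp only [List.countP_append, List.countP_singleton, decide_eq_true_eq, lt_irrefl,
          if_false] at h5 h6
        split_ifs at h5 with hz
        · have : r'.countP (· < i) ≤ r'.countP (· < z) :=
            List.countP_mono_left fun e _ he => by simp at he ⊢; omega
          have : w.countP (· ≤ z) ≤ w.length := List.countP_le_length
          omega
        · exact h5
      have hd := hlt _ (by cases t with
        | nil => simp
        | cons s t => exact hle.2 s (by simp)) h3
      refine ⟨?_, ?_⟩
      · rw [List.map_cons, IsCorner, headD_map_length]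
        have := hd.length_le
        simp only [List.length_append, List.length_singleton]
        omega
      · rcases eq_or_ne r' [] with rfl | hr
        · refine ⟨[], trivial, by simp [BoxFits], ?_⟩
          have := hd.length_le
          cases t with
          | nil => rfl
          | cons s t => exact absurd (by simpa using this) h4.1
        · refine ⟨r' :: t, ⟨hr, (List.pairwise_append.1 h2).1, hd, h4⟩, ⟨?_, by simp⟩, rfl⟩
          simp only [List.forall_mem_cons]
          exact ⟨fun e he => hle.1 e (by simp [he]), hle.2⟩
    | succ k =>
      rw [maxAt_succ_cons] at h
      obtain ⟨hc, Q', hQ1, hQ2, rfl⟩ := ih h4 h.2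
      refine ⟨hc, r :: Q', ⟨h1, h2, ?_, hQ1⟩, boxFits_succ_cons.2 ⟨h.1, hQ2⟩, rfl⟩
      cases Q' with
      | nil => exact dominates_nil r
      | cons s t =>
        cases k with
        | zero =>
          intro z
          have := h3 z
          simp only [addBox_zero_cons, List.headD_cons, List.countP_append] at this ⊢
          omega
        | succ k => exact h3

/-! ### The algorithm on ordered lists of columns, and its inverse. -/

/-- The tableaux obtained by processing a list of columns. -/
def rskList (l : List (ℕ × ℕ)) : List (List ℕ) × List (List ℕ) :=
  l.foldl rskStep ([], [])

theorem rskList_append_singleton (l : List (ℕ × ℕ)) (c : ℕ × ℕ) :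
    rskList (l ++ [c]) = rskStep (rskList l) c := by
  simp [rskList]

/-- The order in which the columns of a generalized permutation are arranged. -/
def ColumnLE (c d : ℕ × ℕ) : Prop := c.1 < d.1 ∨ c.1 = d.1 ∧ c.2 ≤ d.2

/-- A pair of tableaux of the same shape. -/
structure IsTableauPair (PQ : List (List ℕ) × List (List ℕ)) : Prop where
  left : IsTableau PQ.1
  right : IsTableau PQ.2
  map_length : PQ.1.map List.length = PQ.2.map List.length

theorem insertion_snd_le_length (x : ℕ) (T : List (List ℕ)) : (insertion x T).2 ≤ T.length := by
  induction T generalizing x with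
  | nil => simp [insertion]
  | cons r t ih =>
    rcases rowInsert_cases x r with ⟨-, e⟩ | ⟨a, y, b, rfl, -, -, e⟩
    · rw [insertion_cons_none e]; exact Nat.zero_le _
    · rw [insertion_cons_some e]; exact Nat.succ_le_succ (ih y)

theorem IsTableauPair.length_eq {PQ : List (List ℕ) × List (List ℕ)} (h : IsTableauPair PQ) :
    PQ.1.length = PQ.2.length := by
  simpa using congrArg List.length h.map_length

theorem IsTableauPair.rskStep {PQ : List (List ℕ) × List (List ℕ)} (h : IsTableauPair PQ)
    {c : ℕ × ℕ} (hc : BoxFits c.1 (insertion c.2 PQ.1).2 PQ.2) :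
    IsTableauPair (rskStep PQ c) ∧ MaxAt c.1 (insertion c.2 PQ.1).2 (rskStep PQ c).2 := by
  have hP := isTableau_insertion (x := c.2) h.left
  have hl : (insertion c.2 PQ.1).1.map List.length =
      (addBox c.1 (insertion c.2 PQ.1).2 PQ.2).map List.length := by
    rw [map_length_insertion, map_length_addBox, h.map_length]
  exact ⟨⟨hP, isTableau_addBox h.right hc hP hl, hl⟩,
    maxAt_addBox (h.length_eq ▸ insertion_snd_le_length _ _) hc⟩

/-- A larger top letter fits anywhere. For an equal one, the new row is weakly above the previous
one, and the rows above that contain only smaller letters. -/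
theorem boxFits_rskStep {PQ : List (List ℕ) × List (List ℕ)} (h : IsTableauPair PQ)
    {c d : ℕ × ℕ} (hcd : ColumnLE c d)
    (hc : MaxAt c.1 (insertion c.2 PQ.1).2 (rskStep PQ c).2) :
    BoxFits d.1 (insertion d.2 (rskStep PQ c).1).2 (rskStep PQ c).2 := by
  rcases hcd with hcd | ⟨h1, h2⟩
  · have hlt : ∀ r ∈ (rskStep PQ c).2, ∀ e ∈ r, e < d.1 := fun r hr e he =>
      (hc.1.1 r hr e he).trans_lt hcd
    exact ⟨fun r hr e he => (hlt r hr e he).le, fun r hr => hlt r (List.mem_of_mem_take hr)⟩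
  · rw [h1] at hc
    exact ⟨hc.1.1, fun r hr => hc.1.2 r
      (List.take_subset_take_left _ (insertion_snd_le h2 h.left) hr)⟩

/-- The second clause keeps track of where the last box went; it drives the induction and later
allows the last column to be read off from the result. -/
theorem rskList_spec {l : List (ℕ × ℕ)} (hl : l.IsChain ColumnLE) :
    IsTableauPair (rskList l) ∧ ∀ l₀ c, l = l₀ ++ [c] → IsTableauPair (rskList l₀) ∧
      MaxAt c.1 (insertion c.2 (rskList l₀).1).2 (rskList l).2 := by
  induction l using List.reverseRecOn with
  | nil => exact ⟨⟨trivial, trivial, rfl⟩, by simp⟩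
  | append_singleton l d ih =>
    obtain ⟨h1, -, h3⟩ := List.isChain_append.1 hl
    obtain ⟨ih1, ih2⟩ := ih h1
    have hfit : BoxFits d.1 (insertion d.2 (rskList l).1).2 (rskList l).2 := by
      rcases List.eq_nil_or_concat' l with rfl | ⟨l, c, rfl⟩
      · simp [rskList, BoxFits]
      · obtain ⟨hT, hm⟩ := ih2 l c rfl
        rw [rskList_append_singleton] at hm ⊢
        exact boxFits_rskStep hT (h3 c (by simp) d (by simp)) hm
    rw [rskList_append_singleton]
    refine ⟨(ih1.rskStep hfit).1, ?_⟩
    intro l₀ c h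
    obtain ⟨rfl, h⟩ := List.append_inj' h rfl
    obtain rfl : d = c := by simpa using h
    exact ⟨ih1, (ih1.rskStep hfit).2⟩

theorem rskList_perm (l : List (ℕ × ℕ)) :
    (rskList l).1.flatten.Perm (l.map Prod.snd) ∧
      (rskList l).2.flatten.Perm (l.map Prod.fst) := by
  induction l using List.reverseRecOn with
  | nil => exact ⟨.refl _, .refl _⟩
  | append_singleton l c ih =>
    rw [rskList_append_singleton]
    simp only [List.map_append, List.map_cons, List.map_nil, rskStep]
    exact ⟨((flatten_insertion_perm _ _).trans (ih.1.cons _)).trans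
        (List.perm_append_singleton _ _).symm,
      ((flatten_addBox_perm _ _ _).trans (ih.2.cons _)).trans
        (List.perm_append_singleton _ _).symm⟩

/-- `MaxAt.unique` recovers the last top letter and the row of its box; then insertion and `addBox`
are undone and the induction continues with shorter lists. -/
theorem rskList_injective {l l' : List (ℕ × ℕ)} (hl : l.IsChain ColumnLE)
    (hl' : l'.IsChain ColumnLE) (h : rskList l = rskList l') : l = l' := by
  have hlen : l.length = l'.length := by
    have h1 := (rskList_perm l).1.length_eq
    have h2 := (rskList_perm l').1.length_eq
    rw [h, h2] at h1
    simpa using h1.symm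
  induction l using List.reverseRecOn generalizing l' with
  | nil => exact (List.length_eq_zero_iff.1 hlen.symm).symm
  | append_singleton l c ih =>
    rcases List.eq_nil_or_concat' l' with rfl | ⟨l', c', rfl⟩
    · simp at hlen
    · obtain ⟨hT, hm⟩ := (rskList_spec hl).2 l c rfl
      obtain ⟨hT', hm'⟩ := (rskList_spec hl').2 l' c' rfl
      rw [← h] at hm'
      obtain ⟨hi, hk⟩ := hm.unique hm'
      have h1 := (List.isChain_append.1 hl).1
      have h1' := (List.isChain_append.1 hl').1
      simp only [rskList_append_singleton, rskStep, Prod.mk.injEq] at h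
      obtain ⟨hj, hP⟩ := insertion_injective hT.left hT'.left (Prod.ext h.1 hk)
      rw [← hk, ← hi] at h
      have hQ := addBox_injective hT.right hT'.right h.2
      rw [ih h1 h1' (Prod.ext hP hQ) (by simpa using hlen), Prod.ext hi hj]

theorem IsTableau.zero_notMem {T : List (List ℕ)} (h : IsTableau T) :
    0 ∉ T.map List.length := by
  simp only [List.mem_map, List.length_eq_zero_iff, not_exists, not_and]
  exact h.ne_nil

theorem exists_rskList_eq {PQ : List (List ℕ) × List (List ℕ)} (h : IsTableauPair PQ) :
    ∃ l, l.IsChain ColumnLE ∧ rskList l = PQ := by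
  induction hn : PQ.2.flatten.length generalizing PQ with
  | zero =>
    have hnil : PQ.2 = [] := by
      cases hQ : PQ.2 with
      | nil => rfl
      | cons r t =>
        have := h.right.ne_nil r (by simp [hQ])
        simp_all
    have hnil' : PQ.1 = [] := by simpa [hnil] using h.length_eq
    exact ⟨[], by simp, (Prod.ext hnil' hnil).symm⟩
  | succ n ih =>
    obtain ⟨P, Q⟩ := PQ
    obtain ⟨i, k, hm⟩ := exists_maxAt h.right (by rintro rfl; simp at hn)
    obtain ⟨hc, Q', hQ', hfit, rfl⟩ := exists_addBox_eq h.right hm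
    obtain ⟨j, P', hP', he⟩ := exists_insertion_eq h.left (h.map_length ▸ hc)
    have hlen : P'.map List.length = Q'.map List.length := by
      refine incrRow_injective (k := k) hP'.zero_notMem hQ'.zero_notMem ?_
      have := map_length_insertion j P'
      rw [he] at this
      rw [← this, ← map_length_addBox i]
      exact h.map_length
    obtain ⟨l, hl, hPQ⟩ := ih (PQ := (P', Q')) ⟨hP', hQ', hlen⟩ (by
      have := (flatten_addBox_perm i k Q').length_eq
      simp only [List.length_cons] at this hn
      simpa [hn] using this.symm)
    refine ⟨l ++ [(i, j)], List.isChain_append.2 ⟨hl, by simp, ?_⟩, ?_⟩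
    · intro c hcl d hd
      obtain rfl : (i, j) = d := by simpa using hd
      obtain ⟨l, rfl⟩ := List.getLast?_eq_some_iff.1 hcl
      obtain ⟨hT, hm'⟩ := (rskList_spec hl).2 l c rfl
      rw [hPQ] at hm'
      rw [rskList_append_singleton, rskStep, Prod.mk.injEq] at hPQ
      obtain ⟨r, hr, hcr⟩ := List.mem_flatten.1 hm'.mem_flatten
      have hci := hfit.1 r hr _ hcr
      rcases hci.lt_or_eq with hci | hci
      · exact Or.inl hci
      · refine Or.inr ⟨hci, ?_⟩
        -- If the bottom letters decreased under equal top letters, row `k` would lie strictly below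
        -- the preceding box, which also contains `i`; but `hfit` says that no row above `k`
        -- contains `i`.
        by_contra! hj
        have h1 := insertion_snd_lt hj hT.left
        rw [hPQ.1, he] at h1
        have h2 := hm'.le_of_boxFits (hci ▸ hfit)
        exact absurd h1 (not_lt.2 h2)
    · rw [rskList_append_singleton, hPQ]
      simp [rskStep, he]

/-! ### The first row and increasing subsequences (Schensted). -/

theorem headD_rskList_append_singleton (l : List (ℕ × ℕ)) (c : ℕ × ℕ) :
    ((rskList (l ++ [c])).1).headD [] = (rowInsert c.2 ((rskList l).1.headD [])).1 := by
  rw [rskList_append_singleton, rskStep, headD_insertion]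

/-- The number of entries at most `y` in the first row of `P` is the greatest length of a weakly
increasing subsequence with entries at most `y`. -/
theorem isGreatest_countP_headD (w : ℕ → ℕ × ℕ) (m : ℕ) :
    (((rskList ((List.range m).map w)).1).headD []).Pairwise (· ≤ ·) ∧
    ∀ y, IsGreatest
      {a | ∃ S : Finset ℕ, S ⊆ Finset.range m ∧ (∀ r ∈ S, ∀ s ∈ S, r ≤ s → (w r).2 ≤ (w s).2) ∧
        (∀ r ∈ S, (w r).2 ≤ y) ∧ S.card = a}
      (((rskList ((List.range m).map w)).1.headD []).countP (· ≤ y)) := by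
  induction m with
  | zero =>
    refine ⟨by simp [rskList], fun y => ⟨⟨∅, by simp [rskList]⟩, ?_⟩⟩
    rintro a ⟨S, hS, -, -, rfl⟩
    simp_all
  | succ m ih =>
    obtain ⟨ih1, ih2⟩ := ih
    rw [List.range_succ, List.map_append, List.map_singleton,
      headD_rskList_append_singleton]
    refine ⟨pairwise_rowInsert ih1, fun y => ?_⟩
    -- The optimum follows the same recursion: a subsequence using position `m` ends there, so the
    -- rest is a subsequence with values at most `(w m).2`, and it is admissible only if `(w m).2 ≤
    -- y`.
    rw [countP_le_rowInsert ih1]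
    set cnt : ℕ → ℕ := fun y => ((rskList ((List.range m).map w)).1.headD []).countP (· ≤ y)
    have hget : ∀ y, ∃ S : Finset ℕ, S ⊆ Finset.range m ∧
        (∀ r ∈ S, ∀ s ∈ S, r ≤ s → (w r).2 ≤ (w s).2) ∧ (∀ r ∈ S, (w r).2 ≤ y) ∧
          S.card = cnt y := fun y => (ih2 y).1
    have hub : ∀ y, ∀ S : Finset ℕ, S ⊆ Finset.range m →
        (∀ r ∈ S, ∀ s ∈ S, r ≤ s → (w r).2 ≤ (w s).2) → (∀ r ∈ S, (w r).2 ≤ y) →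
          S.card ≤ cnt y := fun y S h1 h2 h3 => (ih2 y).2 ⟨S, h1, h2, h3, rfl⟩
    change IsGreatest _ (if (w m).2 ≤ y then max (cnt y) (cnt (w m).2 + 1) else cnt y)
    have hsub : Finset.range m ⊆ Finset.range (m + 1) := Finset.range_mono (Nat.le_succ m)
    constructor
    · have hold : ∃ S : Finset ℕ, S ⊆ Finset.range (m + 1) ∧
          (∀ r ∈ S, ∀ s ∈ S, r ≤ s → (w r).2 ≤ (w s).2) ∧ (∀ r ∈ S, (w r).2 ≤ y) ∧
          S.card = cnt y := by
        obtain ⟨S, h1, h2⟩ := hget y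
        exact ⟨S, h1.trans hsub, h2⟩
      split_ifs with hy
      · rcases max_choice (cnt y) (cnt (w m).2 + 1) with h | h <;> rw [h]
        · exact hold
        · obtain ⟨S, h1, h2, h3, h4⟩ := hget (w m).2
          have hm : m ∉ S := fun h => by simpa using h1 h
          refine ⟨insert m S, ?_, ?_, ?_, by rw [Finset.card_insert_of_notMem hm, h4]⟩
          · rw [Finset.range_add_one]
            exact Finset.insert_subset_insert m h1
          · intro r hr s hs hrs
            rcases Finset.mem_insert.1 hr with rfl | hr' <;>
            rcases Finset.mem_insert.1 hs with rfl | hs'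
            · exact le_rfl
            · have := Finset.mem_range.1 (h1 hs')
              omega
            · exact h3 r hr'
            · exact h2 r hr' s hs' hrs
          · intro r hr
            rcases Finset.mem_insert.1 hr with rfl | hr
            · exact hy
            · exact (h3 r hr).trans hy
      · exact hold
    · rintro a ⟨S, h1, h2, h3, rfl⟩
      have herase : S.erase m ⊆ Finset.range m := by
        rwa [Finset.range_add_one, Finset.subset_insert_iff] at h1
      by_cases hm : m ∈ S
      · rw [if_pos (h3 m hm), ← Finset.card_erase_add_one hm]
        refine le_max_of_le_right (Nat.succ_le_succ (hub _ _ herase ?_ ?_))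
        · exact fun r hr s hs => h2 r (Finset.mem_of_mem_erase hr) s (Finset.mem_of_mem_erase hs)
        · intro r hr
          have := Finset.mem_range.1 (herase hr)
          exact h2 r (Finset.mem_of_mem_erase hr) m hm this.le
      · rw [Finset.erase_eq_of_notMem hm] at herase
        have := hub y S herase h2 h3
        split_ifs
        · exact le_max_of_le_left this
        · exact this

variable {p q n : ℕ}

/-- The columns of a generalized permutation. -/
def GenPerm.columns (π : GenPerm p q n) : List (ℕ × ℕ) :=
  List.ofFn fun k : Fin n => ((π.top k : ℕ), (π.bot k : ℕ))

theorem GenPerm.isChain_columns (π : GenPerm p q n) : π.columns.IsChain ColumnLE := by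
  rw [List.isChain_iff_getElem]
  intro k hk
  simp only [GenPerm.columns, List.length_ofFn] at hk
  simp only [GenPerm.columns, List.getElem_ofFn, ColumnLE]
  rcases (π.top_mono (show (⟨k, by omega⟩ : Fin n) ≤ ⟨k + 1, hk⟩ by simp)).lt_or_eq with h | h
  · exact Or.inl h
  · exact Or.inr ⟨congrArg Fin.val h, π.bot_le _ _ rfl h⟩

theorem GenPerm.isGreatest_increasingLengths (π : GenPerm p q n) :
    IsGreatest π.increasingLengths ((rsk π).1.headD []).length := by
  classical
  set w : ℕ → ℕ × ℕ := fun k => if h : k < n then ((π.top ⟨k, h⟩ : ℕ), (π.bot ⟨k, h⟩ : ℕ)) else 0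
    with hw
  have hwv : ∀ k : Fin n, w k = ((π.top k : ℕ), (π.bot k : ℕ)) := fun k => by simp [hw]
  have hcol : (List.range n).map w = π.columns := by
    rw [GenPerm.columns, List.ofFn_eq_map, ← List.map_coe_finRange_eq_range, List.map_map]
    exact List.map_congr_left fun k _ => hwv k
  -- All bottom letters are smaller than `q`, so the threshold `q` counts the whole row and imposes
  -- nothing on subsequences.
  have hlen : ((rsk π).1.headD []).countP (· ≤ q) = ((rsk π).1.headD []).length := by
    refine List.countP_eq_length.2 fun e he => ?_
    have hmem : e ∈ (rskList π.columns).1.flatten := by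
      change e ∈ ((rskList π.columns).1.headD []) at he
      cases hP : (rskList π.columns).1 with
      | nil => simp [hP] at he
      | cons r t =>
        rw [hP] at he
        exact List.mem_flatten.2 ⟨r, by simp, he⟩
    rw [(rskList_perm π.columns).1.mem_iff] at hmem
    simp only [GenPerm.columns, List.map_ofFn, List.mem_ofFn, Function.comp_apply] at hmem
    obtain ⟨k, rfl⟩ := hmem
    simp
  have key := (isGreatest_countP_headD w n).2 q
  rw [hcol, show rskList π.columns = rsk π from rfl, hlen] at key
  convert key using 1
  ext a
  constructor
  · rintro ⟨S, hS, rfl⟩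
    refine ⟨S.map Fin.valEmbedding, ?_, ?_, ?_, by simp⟩
    · intro k hk
      obtain ⟨k, -, rfl⟩ := Finset.mem_map.1 hk
      simp
    · simp only [Finset.mem_map, Fin.valEmbedding_apply, forall_exists_index, and_imp,
        forall_apply_eq_imp_iff₂, hwv]
      exact fun r hr s hs => hS r hr s hs
    · simp only [Finset.mem_map, Fin.valEmbedding_apply, forall_exists_index, and_imp,
        forall_apply_eq_imp_iff₂, hwv]
      exact fun r _ => (π.bot r).2.le
  · rintro ⟨S, h1, h2, -, rfl⟩
    refine ⟨S.attachFin fun k hk => Finset.mem_range.1 (h1 hk), ?_, by simp⟩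
    intro r hr s hs hrs
    have := h2 r (by simpa using hr) s (by simpa using hs) hrs
    rw [hwv, hwv] at this
    exact this

/-! ### Chains of matrix positions and right/down paths. -/

theorem PathStep.lt {a b : Fin p × Fin q} (h : PathStep a b) : a < b := by
  rw [Prod.lt_iff]
  rcases h with ⟨h1, h2⟩ | ⟨h1, h2⟩
  · exact Or.inr ⟨h1.ge, by rw [Fin.lt_def]; omega⟩
  · exact Or.inl ⟨by rw [Fin.lt_def]; omega, h2.ge⟩

theorem pairwise_lt_of_isChain_pathStep {γ : List (Fin p × Fin q)} (h : γ.IsChain PathStep) :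
    γ.Pairwise (· < ·) :=
  List.isChain_iff_pairwise.1 (h.imp fun _ _ => PathStep.lt)

/-- Pairwise comparable entries lie on a common right/down path. -/
theorem exists_path_of_isChain (b : Fin p × Fin q) (C : Set (Fin p × Fin q))
    (hC : ∀ c ∈ C, ∀ d ∈ C, c ≤ d ∨ d ≤ c) (hb : ∀ c ∈ C, c ≤ b) :
    ∃ γ : List (Fin p × Fin q), γ.IsChain PathStep ∧
      (∃ a ∈ γ.head?, (a.1 : ℕ) = 0 ∧ (a.2 : ℕ) = 0) ∧ b ∈ γ.getLast? ∧ ∀ c ∈ C, c ∈ γ := by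
  induction hs : (b.1 : ℕ) + b.2 generalizing b C with
  | zero =>
    refine ⟨[b], by simp, ⟨b, by simp, by omega, by omega⟩, by simp, fun c hc => ?_⟩
    have hcb := hb c hc
    rw [Prod.le_def, Fin.le_def, Fin.le_def] at hcb
    rw [List.mem_singleton]
    exact Prod.ext (Fin.ext (by omega)) (Fin.ext (by omega))
  | succ s ih =>
    -- The path is built backwards from `b`: it suffices to find a predecessor `b'` that still
    -- bounds all other elements of `C`.
    have step : ∀ b' : Fin p × Fin q, PathStep b' b → (∀ c ∈ C \ {b}, c ≤ b') →
        ∃ γ : List (Fin p × Fin q), γ.IsChain PathStep ∧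
          (∃ a ∈ γ.head?, (a.1 : ℕ) = 0 ∧ (a.2 : ℕ) = 0) ∧ b ∈ γ.getLast? ∧ ∀ c ∈ C, c ∈ γ := by
      intro b' hb' hle
      have hsum : (b'.1 : ℕ) + b'.2 = s := by
        rcases hb' with ⟨h1, h2⟩ | ⟨h1, h2⟩
        · rw [h1] at hs; omega
        · rw [h2] at hs; omega
      obtain ⟨γ, h1, ⟨a, h2, h3⟩, h4, h5⟩ :=
        ih b' (C \ {b}) (fun c hc d hd => hC c hc.1 d hd.1) hle hsum
      refine ⟨γ ++ [b], List.isChain_append.2 ⟨h1, by simp, ?_⟩, ⟨a, ?_, h3⟩, by simp, ?_⟩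
      · intro x hx y hy
        obtain rfl : b = y := by simpa using hy
        obtain rfl := Option.mem_unique h4 hx
        exact hb'
      · cases γ with
        | nil => simp at h2
        | cons => exact h2
      · intro c hc
        by_cases hcb : c = b
        · simp [hcb]
        · exact List.mem_append_left _ (h5 c ⟨hc, hcb⟩)
    by_cases h1 : 0 < (b.1 : ℕ) ∧ ∀ c ∈ C \ {b}, (c.1 : ℕ) < b.1
    · refine step (⟨b.1 - 1, by omega⟩, b.2) (Or.inr ⟨?_, rfl⟩) fun c hc => ⟨?_, (hb c hc.1).2⟩
      · simp only; omega
      · have := h1.2 c hc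
        rw [Fin.le_def]
        simp only
        omega
    by_cases h2 : 0 < (b.2 : ℕ) ∧ ∀ c ∈ C \ {b}, (c.2 : ℕ) < b.2
    · refine step (b.1, ⟨b.2 - 1, by omega⟩) (Or.inl ⟨rfl, ?_⟩) fun c hc => ⟨(hb c hc.1).1, ?_⟩
      · simp only; omega
      · have := h2.2 c hc
        rw [Fin.le_def]
        simp only
        omega
    -- If neither moving up nor moving left is possible, `C` contains some `c ≠ b` in the row of `b`
    -- and some `d ≠ b` in its column, and these are incomparable.
    exfalso
    have hle : ∀ c ∈ C \ {b}, (c.1 : ℕ) ≤ b.1 ∧ (c.2 : ℕ) ≤ b.2 ∧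
        ((c.1 : ℕ) = b.1 → (c.2 : ℕ) ≠ b.2) := fun c hc =>
      ⟨(hb c hc.1).1, (hb c hc.1).2, fun h h' => hc.2 (Prod.ext (Fin.ext h) (Fin.ext h'))⟩
    rcases Nat.eq_zero_or_pos (b.1 : ℕ) with h3 | h3
    · refine h2 ⟨by omega, fun c hc => ?_⟩
      have := hle c hc
      omega
    rcases Nat.eq_zero_or_pos (b.2 : ℕ) with h4 | h4
    · refine h1 ⟨by omega, fun c hc => ?_⟩
      have := hle c hc
      omega
    push Not at h1 h2
    obtain ⟨c, hc, hc'⟩ := h1 h3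
    obtain ⟨d, hd, hd'⟩ := h2 h4
    have hc1 := hle c hc
    have hd1 := hle d hd
    have hcd := hC c hc.1 d hd.1
    simp only [Prod.le_def, Fin.le_def] at hcd
    omega

theorem GenPerm.bot_le_of_le (π : GenPerm p q n) {k l : Fin n} (hkl : k ≤ l)
    (h : π.top k = π.top l) : π.bot k ≤ π.bot l := by
  obtain ⟨l, hl⟩ := l
  obtain ⟨d, rfl⟩ : ∃ d, l = k + d := Nat.exists_eq_add_of_le hkl
  induction d with
  | zero => exact le_rfl
  | succ d ih =>
    have h1 : π.top k ≤ π.top ⟨k + d, by omega⟩ := π.top_mono (by simp [Fin.le_def])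
    have h2 : π.top ⟨k + d, by omega⟩ ≤ π.top ⟨k + (d + 1), hl⟩ :=
      π.top_mono (by simp [Fin.le_def])
    have h3 : π.top k = π.top ⟨k + d, by omega⟩ := le_antisymm h1 (h ▸ h2)
    exact (ih (by omega) (by simp [Fin.le_def]) h3).trans (π.bot_le _ _ (by simp; omega) (h3 ▸ h))

theorem GenPerm.card_filter_mem (π : GenPerm p q n) {γ : List (Fin p × Fin q)} (hγ : γ.Nodup) :
    (Finset.univ.filter fun k : Fin n => (π.top k, π.bot k) ∈ γ).card =
      (γ.map fun c => π.mult c.1 c.2).sum := by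
  rw [← List.sum_toFinset _ hγ,
    Finset.card_eq_sum_card_fiberwise (f := fun k => (π.top k, π.bot k)) (t := γ.toFinset)
      (by intro k; simp)]
  refine Finset.sum_congr rfl fun c hc => ?_
  rw [GenPerm.mult, Finset.filter_filter]
  congr 1
  ext k
  simp only [List.mem_toFinset] at hc
  simp only [Finset.mem_filter, Finset.mem_univ, true_and, Prod.ext_iff]
  constructor
  · exact fun h => h.2
  · intro h
    exact ⟨by rw [h.1, h.2]; exact hc, h⟩

/-- The weight of a path counts the columns of `π` lying on it. They form an increasing subsequence:
comparable pairs are in the right order, equal top letters being handled by `GenPerm.bot_le_of_le`.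
Conversely an increasing subsequence occupies pairwise comparable positions, which one path can
collect. -/
theorem GenPerm.isGreatest_pathWeights (π : GenPerm p q n) (hp : 0 < p) (hq : 0 < q) {m : ℕ}
    (hm : IsGreatest π.increasingLengths m) :
    IsGreatest (pathWeights fun i j => π.mult i j) m := by
  have hub : ∀ γ : List (Fin p × Fin q), γ.IsChain PathStep →
      (γ.map fun c => π.mult c.1 c.2).sum ≤ m := by
    intro γ hγ
    have hlt := pairwise_lt_of_isChain_pathStep hγ
    have hnd : γ.Nodup := hlt.imp fun h => h.ne
    have hcmp : ∀ c ∈ γ, ∀ d ∈ γ, c ≤ d ∨ d ≤ c := by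
      intro c hc d hd
      have : Std.Symm fun c d : Fin p × Fin q => c ≤ d ∨ d ≤ c := ⟨fun _ _ => Or.symm⟩
      exact List.Pairwise.forall_of_forall (R := fun c d => c ≤ d ∨ d ≤ c)
        (fun _ _ => Or.inl le_rfl) (hlt.imp fun h => Or.inl h.le) hc hd
    rw [← π.card_filter_mem hnd]
    refine hm.2 ⟨_, ?_, rfl⟩
    intro r hr s hs hrs
    simp only [Finset.mem_filter, Finset.mem_univ, true_and] at hr hs
    rcases hcmp _ hr _ hs with h | h
    · exact h.2
    · exact π.bot_le_of_le hrs (le_antisymm (π.top_mono hrs) h.1)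
  constructor
  · obtain ⟨S, hS, hcard⟩ := hm.1
    obtain ⟨γ, h1, h2, h3, h4⟩ := exists_path_of_isChain
      ((⟨p - 1, by omega⟩, ⟨q - 1, by omega⟩) : Fin p × Fin q)
      ((fun k => (π.top k, π.bot k)) '' S) (by
        rintro _ ⟨r, hr, rfl⟩ _ ⟨s, hs, rfl⟩
        rcases le_total r s with h | h
        · exact Or.inl ⟨π.top_mono h, hS r hr s hs h⟩
        · exact Or.inr ⟨π.top_mono h, hS s hs r hr h⟩) (by
        rintro c -
        have := c.1.2
        have := c.2.2
        simp only [Prod.le_def, Fin.le_def]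
        omega)
    refine ⟨γ, ⟨h1, h2, _, h3, by simp only; omega, by simp only; omega⟩,
      le_antisymm (hub γ h1) ?_⟩
    have hnd : γ.Nodup := (pairwise_lt_of_isChain_pathStep h1).imp fun h => h.ne
    rw [← π.card_filter_mem hnd, ← hcard]
    refine Finset.card_le_card fun k hk => ?_
    simpa using h4 _ ⟨k, hk, rfl⟩
  · rintro w ⟨γ, hγ, rfl⟩
    exact hub γ hγ.1

/-! ### Lists of rows versus semistandard Young tableaux. -/

/-- In a sorted list a downward closed property holds exactly on an initial segment, whose length is
the count. -/
theorem lt_countP_iff {P : ℕ → Prop} [DecidablePred P] (hP : ∀ a b, a ≤ b → P b → P a)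
    {l : List ℕ} (hl : l.Pairwise (· ≤ ·)) {j : ℕ} (hj : j < l.length) :
    j < l.countP (P ·) ↔ P l[j] := by
  induction l generalizing j with
  | nil => simp at hj
  | cons x l ih =>
    rw [List.pairwise_cons] at hl
    rw [List.countP_cons]
    by_cases hx : P x
    · simp only [hx, decide_true, if_true]
      cases j with
      | zero => simp [hx]
      | succ j =>
        rw [List.getElem_cons_succ, ← ih hl.2 (by simpa using hj)]
        omega
    · have h : ∀ y ∈ l, ¬ P y := fun y hy h => hx (hP x y (hl.1 y hy) h)
      have h0 : l.countP (P ·) = 0 := List.countP_eq_zero.2 (by simpa using h)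
      simp only [h0, hx, decide_false, Bool.false_eq_true, if_false]
      have : ∀ y ∈ x :: l, ¬ P y := by simpa using ⟨hx, h⟩
      simpa using this _ (List.getElem_mem hj)

/-- Translates the counting condition, convenient for bumping, into entrywise strictness of columns.
-/
theorem dominates_iff {r s : List ℕ} (hr : r.Pairwise (· ≤ ·)) (hs : s.Pairwise (· ≤ ·)) :
    Dominates r s ↔ s.length ≤ r.length ∧
      ∀ j (h : j < s.length) (h' : j < r.length), r[j] < s[j] := by
  constructor
  · intro h
    refine ⟨h.length_le, fun j hjs hjr => ?_⟩
    have h1 := (lt_countP_iff (P := (· ≤ s[j])) (fun a b hab hb => hab.trans hb) hs hjs).2 le_rfl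
    exact (lt_countP_iff (P := (· < s[j])) (fun a b hab hb => hab.trans_lt hb) hr hjr).1
      (h1.trans_le (h _))
  · rintro ⟨h1, h2⟩ z
    by_contra! hlt
    have hjs := hlt.trans_le List.countP_le_length
    have hjr := hjs.trans_le h1
    have h3 := (lt_countP_iff (P := (· ≤ z)) (fun a b hab hb => hab.trans hb) hs hjs).1 hlt
    have h4 := (lt_countP_iff (P := (· < z)) (fun a b hab hb => hab.trans_lt hb) hr hjr).2
      ((h2 _ hjs hjr).trans_le h3)
    exact lt_irrefl _ h4

instance : IsTrans (List ℕ) Dominates where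
  trans r s t hrs hst z :=
    ((hst z).trans (List.countP_mono_left fun e _ he => by simp at he ⊢; omega)).trans (hrs z)

theorem isTableau_iff {T : List (List ℕ)} :
    IsTableau T ↔ (∀ r ∈ T, r ≠ [] ∧ r.Pairwise (· ≤ ·)) ∧ T.IsChain Dominates := by
  induction T with
  | nil => simp [IsTableau]
  | cons r t ih =>
    rw [IsTableau, ih, List.forall_mem_cons, List.isChain_cons]
    cases t with
    | nil => simp [dominates_nil]
    | cons s t => simp; tauto

theorem IsTableau.pairwise {T : List (List ℕ)} (h : IsTableau T) : T.Pairwise Dominates :=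
  List.isChain_iff_pairwise.1 (isTableau_iff.1 h).2

theorem rowLens_headD (μ : YoungDiagram) : μ.rowLens.headD 0 = μ.rowLen 0 := by
  rw [YoungDiagram.rowLens]
  rcases Nat.eq_zero_or_pos (μ.colLen 0) with h | h
  · have : (0, 0) ∉ μ := by rw [YoungDiagram.mem_iff_lt_colLen]; omega
    rw [YoungDiagram.mem_iff_lt_rowLen] at this
    simp only [h, List.range_zero, List.map_nil, List.headD_nil]
    omega
  · obtain ⟨k, hk⟩ := Nat.exists_eq_add_one.2 h
    simp [hk, List.range_succ_eq_map]

theorem card_eq_sum_rowLens (μ : YoungDiagram) : μ.card = μ.rowLens.sum := by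
  rw [YoungDiagram.card, Finset.card_eq_sum_card_fiberwise (f := Prod.fst)
    (t := Finset.range (μ.colLen 0)), YoungDiagram.rowLens]
  · rw [← List.sum_toFinset _ List.nodup_range, List.toFinset_range]
    exact Finset.sum_congr rfl fun i _ => (μ.rowLen_eq_card).symm
  · rintro ⟨i, j⟩ h
    simp only [Finset.coe_range, Set.mem_Iio, ← YoungDiagram.mem_iff_lt_colLen]
    exact μ.up_left_mem le_rfl (Nat.zero_le j) h

namespace BoundedSSYT

variable {m : ℕ} {μ : YoungDiagram}

theorem map_length_rows (T : BoundedSSYT m μ) : T.rows.map List.length = μ.rowLens := by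
  simp [rows, YoungDiagram.rowLens]

theorem isTableau_rows (T : BoundedSSYT m μ) : IsTableau T.rows := by
  have hpw : ∀ i, ((List.range (μ.rowLen i)).map fun j => T.1 i j).Pairwise (· ≤ ·) := by
    intro i
    rw [List.pairwise_map]
    refine List.pairwise_lt_range.imp_of_mem fun _ hb hab => ?_
    exact T.1.row_weak hab (YoungDiagram.mem_iff_lt_rowLen.2 (List.mem_range.1 hb))
  rw [isTableau_iff]
  constructor
  · simp only [rows, List.mem_map, List.mem_range, forall_exists_index, and_imp,
      forall_apply_eq_imp_iff₂]
    refine fun i hi => ⟨?_, hpw i⟩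
    rw [← YoungDiagram.mem_iff_lt_colLen, YoungDiagram.mem_iff_lt_rowLen] at hi
    simp
    omega
  · rw [List.isChain_iff_getElem]
    intro i hi
    simp only [rows, List.getElem_map, List.getElem_range]
    rw [dominates_iff (hpw _) (hpw _)]
    simp only [List.length_map, List.length_range, List.getElem_map, List.getElem_range]
    exact ⟨μ.rowLen_anti _ _ (Nat.le_succ i), fun j hj _ =>
      T.1.col_strict (Nat.lt_succ_self i) (YoungDiagram.mem_iff_lt_rowLen.2 hj)⟩

theorem mem_rows_lt (T : BoundedSSYT m μ) : ∀ e ∈ T.rows.flatten, e < m := by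
  simp only [rows, List.mem_flatten, List.mem_map, List.mem_range, exists_exists_and_eq_and,
    forall_exists_index, and_imp]
  intro e i _ j hj rfl
  exact T.2 (i, j) (YoungDiagram.mem_iff_lt_rowLen.2 hj)

theorem rows_injective {T T' : BoundedSSYT m μ} (h : T.rows = T'.rows) : T = T' := by
  apply Subtype.ext
  ext i j
  by_cases hc : (i, j) ∈ μ
  · have hi : i < μ.colLen 0 :=
      YoungDiagram.mem_iff_lt_colLen.1 (μ.up_left_mem le_rfl (Nat.zero_le j) hc)
    simp only [rows] at h
    have h1 := (List.map_inj_left.1 h) i (List.mem_range.2 hi)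
    exact (List.map_inj_left.1 h1) j
      (List.mem_range.2 (YoungDiagram.mem_iff_lt_rowLen.1 hc))
  · rw [T.1.zeros hc, T'.1.zeros hc]

end BoundedSSYT

/-- The Young diagram of a list of rows forming a tableau. -/
def IsTableau.shape {L : List (List ℕ)} (h : IsTableau L) : YoungDiagram :=
  YoungDiagram.ofRowLens (L.map List.length) (by
    refine List.Pairwise.sortedGE (List.pairwise_map.2 ?_)
    exact h.pairwise.imp fun h => h.length_le)

theorem IsTableau.mem_shape {L : List (List ℕ)} (h : IsTableau L) {i j : ℕ} :
    (i, j) ∈ h.shape ↔ ∃ hi : i < L.length, j < L[i].length := by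
  simp [IsTableau.shape, YoungDiagram.mem_ofRowLens]

theorem IsTableau.rowLens_shape {L : List (List ℕ)} (h : IsTableau L) :
    h.shape.rowLens = L.map List.length :=
  YoungDiagram.rowLens_ofRowLens_eq_self fun _ hx =>
    Nat.pos_of_ne_zero fun h0 => h.zero_notMem (h0 ▸ hx)

theorem IsTableau.exists_rows_eq {L : List (List ℕ)} (h : IsTableau L) {μ : YoungDiagram}
    (hμ : μ.rowLens = L.map List.length) {m : ℕ} (hm : ∀ e ∈ L.flatten, e < m) :
    ∃ T : BoundedSSYT m μ, T.rows = L := by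
  obtain rfl : μ = h.shape := by
    apply YoungDiagram.equivListRowLens.injective
    apply Subtype.ext
    exact hμ.trans h.rowLens_shape.symm
  have hval : ∀ {i j} (hi : i < L.length) (hj : j < L[i].length),
      (L.getD i []).getD j 0 = L[i][j] := fun hi hj => by simp [hi, hj]
  have hpw : ∀ {i} (hi : i < L.length), L[i].Pairwise (· ≤ ·) := fun hi =>
    ((isTableau_iff.1 h).1 _ (List.getElem_mem hi)).2
  -- The default value `0` outside the rows is the one that `SemistandardYoungTableau` prescribes
  -- outside the diagram.
  refine ⟨⟨⟨fun i j => (L.getD i []).getD j 0, ?_, ?_, ?_⟩, ?_⟩, ?_⟩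
  · intro i j₁ j₂ hj hc
    obtain ⟨hi, hj₂⟩ := h.mem_shape.1 hc
    rw [hval hi (hj.trans hj₂), hval hi hj₂]
    exact List.pairwise_iff_getElem.1 (hpw hi) _ _ _ _ hj
  · intro i₁ i₂ j hi hc
    obtain ⟨hi₂, hj⟩ := h.mem_shape.1 hc
    have hi₁ := hi.trans hi₂
    have hd := List.pairwise_iff_getElem.1 h.pairwise _ _ hi₁ hi₂ hi
    have hj' := hj.trans_le hd.length_le
    rw [hval hi₁ hj', hval hi₂ hj]
    exact ((dominates_iff (hpw hi₁) (hpw hi₂)).1 hd).2 j hj hj'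
  · intro i j hc
    rw [h.mem_shape] at hc
    push Not at hc
    by_cases hi : i < L.length
    · simp [hi, hc hi]
    · simp [not_lt.1 hi]
  · rintro ⟨i, j⟩ hc
    obtain ⟨hi, hj⟩ := h.mem_shape.1 hc
    change (L.getD i []).getD j 0 < m
    rw [hval hi hj]
    exact hm _ (List.mem_flatten.2 ⟨_, List.getElem_mem hi, List.getElem_mem hj⟩)
  · have hlen : h.shape.colLen 0 = L.length := by
      rw [← YoungDiagram.length_rowLens, h.rowLens_shape, List.length_map]
    refine List.ext_getElem (by simp [BoundedSSYT.rows, hlen]) fun i h1 hi => ?_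
    have hrow : h.shape.rowLen i = L[i].length := by
      have h2 : i < h.shape.rowLens.length := by rw [h.rowLens_shape]; simpa using hi
      rw [← YoungDiagram.get_rowLens (h := h2)]
      simp [h.rowLens_shape]
    refine List.ext_getElem (by simp [BoundedSSYT.rows, hrow]) fun j h2 hj => ?_
    simp only [BoundedSSYT.rows, List.getElem_map, List.getElem_range]
    exact hval hi hj

/-! ### Generalized permutations as lists, multisets and matrices. -/

instance : IsTrans (ℕ × ℕ) ColumnLE where
  trans a b c hab hbc := by
    rcases hab with h1 | ⟨h1, h2⟩ <;> rcases hbc with h3 | ⟨h3, h4⟩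
    · exact Or.inl (h1.trans h3)
    · exact Or.inl (h3 ▸ h1)
    · exact Or.inl (h1 ▸ h3)
    · exact Or.inr ⟨h1.trans h3, h2.trans h4⟩

theorem GenPerm.columns_injective :
    Function.Injective (GenPerm.columns : GenPerm p q n → List (ℕ × ℕ)) := by
  intro π π' h
  have h := congrFun (List.ofFn_injective h)
  apply GenPerm.ext
  · exact funext fun k => Fin.ext (congrArg Prod.fst (h k))
  · exact funext fun k => Fin.ext (congrArg Prod.snd (h k))

theorem GenPerm.exists_columns_eq {l : List (ℕ × ℕ)} (hl : l.IsChain ColumnLE)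
    (hlen : l.length = n) (h1 : ∀ e ∈ l.map Prod.fst, e < p) (h2 : ∀ e ∈ l.map Prod.snd, e < q) :
    ∃ π : GenPerm p q n, π.columns = l := by
  subst hlen
  have hpw := List.pairwise_iff_getElem.1 (List.isChain_iff_pairwise.1 hl)
  refine ⟨⟨fun k => ⟨l[k].1, h1 _ (List.mem_map_of_mem (List.getElem_mem _))⟩,
    fun k => ⟨l[k].2, h2 _ (List.mem_map_of_mem (List.getElem_mem _))⟩, ?_, ?_⟩, ?_⟩
  · intro a b hab
    rcases hab.eq_or_lt with rfl | hab
    · exact le_rfl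
    · rw [Fin.mk_le_mk]
      rcases hpw a b a.2 b.2 hab with h | h
      · exact h.le
      · exact h.1.le
  · intro a b hab h
    rw [Fin.mk_eq_mk] at h
    rcases hpw a b a.2 b.2 (by omega) with h' | h'
    · exact absurd h h'.ne
    · exact h'.2
  · exact List.ofFn_getElem

/-- The multiset of columns of a generalized permutation. -/
def GenPerm.columnMultiset (π : GenPerm p q n) : Multiset (Fin p ×ₗ Fin q) :=
  Finset.univ.val.map fun k => toLex (π.top k, π.bot k)

theorem GenPerm.count_columnMultiset (π : GenPerm p q n) (i : Fin p) (j : Fin q) :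
    π.columnMultiset.count (toLex (i, j)) = π.mult i j := by
  rw [columnMultiset, Multiset.count_map, mult, Finset.card_def, Finset.filter_val]
  congr 1
  refine Multiset.filter_congr fun k _ => ?_
  rw [toLex_inj, Prod.mk.injEq, eq_comm, @eq_comm _ j]

theorem GenPerm.monotone_toLex (π : GenPerm p q n) :
    Monotone fun k => toLex (π.top k, π.bot k) := by
  intro k l hkl
  rw [Prod.Lex.toLex_le_toLex]
  rcases (π.top_mono hkl).lt_or_eq with h | h
  · exact Or.inl h
  · exact Or.inr ⟨h, π.bot_le_of_le hkl h⟩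

/-- The columns are sorted lexicographically, and a sorted list is determined by its multiset. -/
theorem GenPerm.columnMultiset_injective :
    Function.Injective (GenPerm.columnMultiset : GenPerm p q n → _) := by
  intro π π' h
  rw [columnMultiset, columnMultiset, Fin.univ_val_map, Fin.univ_val_map, Multiset.coe_eq_coe] at h
  have h := h.eq_of_sortedLE π.monotone_toLex.sortedLE_ofFn π'.monotone_toLex.sortedLE_ofFn
  have h := congrFun (List.ofFn_injective h)
  apply GenPerm.ext
  · exact funext fun k => congrArg (fun c => (ofLex c).1) (h k)
  · exact funext fun k => congrArg (fun c => (ofLex c).2) (h k)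

theorem GenPerm.exists_columnMultiset_eq (s : Multiset (Fin p ×ₗ Fin q)) (hs : s.card = n) :
    ∃ π : GenPerm p q n, π.columnMultiset = s := by
  obtain ⟨l, rfl, hl⟩ : ∃ l : List (Fin p ×ₗ Fin q), ↑l = s ∧ l.Pairwise (· ≤ ·) :=
    ⟨s.sort, s.sort_eq _, s.pairwise_sort _⟩
  rw [Multiset.coe_card] at hs
  subst hs
  have hpw := fun (a b : Fin l.length) (h : a < b) =>
    Prod.Lex.le_iff.1 (List.pairwise_iff_getElem.1 hl a b a.2 b.2 h)
  refine ⟨⟨fun k => (ofLex l[k]).1, fun k => (ofLex l[k]).2, ?_, ?_⟩, ?_⟩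
  · intro a b hab
    rcases hab.eq_or_lt with rfl | hab
    · exact le_rfl
    · rcases hpw a b hab with h | h
      · exact h.le
      · exact h.1.le
  · intro a b hab h
    rcases hpw a b (by rw [Fin.lt_def]; omega) with h' | h'
    · exact absurd h h'.ne
    · exact h'.2
  · rw [columnMultiset, Fin.univ_val_map]
    exact congrArg _ List.ofFn_getElem

theorem GenPerm.sum_mult (π : GenPerm p q n) : ∑ i, ∑ j, π.mult i j = n := by
  rw [← Fintype.sum_prod_type' (f := fun i j => π.mult i j)]
  simp_rw [← π.count_columnMultiset]
  have h := Multiset.sum_count_eq_card (s := Finset.univ) (m := π.columnMultiset) (by simp)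
  rw [columnMultiset, Multiset.card_map, Finset.card_val, Finset.card_univ, Fintype.card_fin] at h
  exact (Fintype.sum_equiv toLex _ _ fun c => rfl).trans h

/-- The matrix of the multiplicities of the columns. -/
def GenPerm.toMatrix (π : GenPerm p q n) : NatMatrix p q n :=
  ⟨fun i j => π.mult i j, π.sum_mult⟩

theorem GenPerm.toMatrix_bijective :
    Function.Bijective (GenPerm.toMatrix : GenPerm p q n → NatMatrix p q n) := by
  constructor
  · intro π π' h
    apply GenPerm.columnMultiset_injective
    ext c
    have := congrFun (congrFun (congrArg Subtype.val h) (ofLex c).1) (ofLex c).2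
    exact (π.count_columnMultiset _ _).trans (this.trans (π'.count_columnMultiset _ _).symm)
  · rintro ⟨W, hW⟩
    set s : Multiset (Fin p ×ₗ Fin q) :=
      ∑ c : Fin p × Fin q, W c.1 c.2 • {toLex c} with hs
    obtain ⟨π, hπ⟩ := GenPerm.exists_columnMultiset_eq (n := n) s (by
      rw [hs, Multiset.card_sum, ← hW, ← Fintype.sum_prod_type' (f := fun i j => W i j)]
      simp)
    refine ⟨π, Subtype.ext (funext fun i => funext fun j => ?_)⟩
    change π.mult i j = W i j
    rw [← π.count_columnMultiset, hπ, hs, Multiset.count_sum']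
    simp only [Multiset.count_nsmul, Multiset.count_singleton, toLex_inj, mul_ite, mul_one,
      mul_zero]
    rw [Finset.sum_ite_eq]
    simp

/-! ### Cardinalities. -/

/-- Stars and bars: the matrices are the multiplicity functions of multisets of size `n` on `p * q`
positions. -/
theorem natCard_natMatrix : Nat.card (NatMatrix p q n) = (p * q + n - 1).choose n := by
  have e : NatMatrix p q n ≃ {P : Fin p × Fin q → ℕ // ∑ i, P i = n} :=
    (Equiv.curry (Fin p) (Fin q) ℕ).symm.subtypeEquiv fun W => by
      rw [Fintype.sum_prod_type]
      rfl
  rw [Nat.card_congr (e.trans (Sym.equivNatSumOfFintype _ n).symm), Sym.natCard_sym_eq_choose]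
  simp

theorem schurAtOnes_eq_natCard (m : ℕ) (μ : YoungDiagram) :
    schurAtOnes m μ = Nat.card (BoundedSSYT m μ) := by
  simp [schurAtOnes, schur]

theorem natCard_tableauPair (a b n : ℕ) :
    Nat.card (TableauPair a b n) = ∑ μ : Diagram n, schurAtOnes a μ.1 * schurAtOnes b μ.1 := by
  have e : TableauPair a b n ≃ Σ μ : Diagram n, BoundedSSYT a μ.1 × BoundedSSYT b μ.1 :=
    { toFun := fun t => ⟨⟨t.shape, t.card_shape⟩, t.P, t.Q⟩
      invFun := fun t => ⟨t.1.1, t.1.2, t.2.1, t.2.2⟩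
      left_inv := fun _ => rfl
      right_inv := fun _ => rfl }
  rw [Nat.card_congr e, Nat.card_sigma]
  simp_rw [Nat.card_prod, schurAtOnes_eq_natCard]

/-! ### The RSK bijection and the theorem. -/

theorem TableauPair.ext_rows {a b n : ℕ} {t t' : TableauPair a b n} (hP : t.P.rows = t'.P.rows)
    (hQ : t.Q.rows = t'.Q.rows) : t = t' := by
  obtain ⟨μ, hμ, P, Q⟩ := t
  obtain ⟨μ', hμ', P', Q'⟩ := t'
  obtain rfl : μ = μ' := by
    apply YoungDiagram.equivListRowLens.injective
    apply Subtype.ext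
    change μ.rowLens = μ'.rowLens
    rw [← P.map_length_rows, ← P'.map_length_rows]
    exact congrArg _ hP
  obtain rfl := BoundedSSYT.rows_injective hP
  obtain rfl := BoundedSSYT.rows_injective hQ
  rfl

theorem TableauPair.isTableauPair_rows {a b n : ℕ} (t : TableauPair a b n) :
    IsTableauPair (t.P.rows, t.Q.rows) :=
  ⟨t.P.isTableau_rows, t.Q.isTableau_rows, by
    rw [BoundedSSYT.map_length_rows, BoundedSSYT.map_length_rows]⟩

theorem TableauPair.length_flatten_rows {a b n : ℕ} (t : TableauPair a b n) :
    t.P.rows.flatten.length = n := by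
  rw [List.length_flatten, BoundedSSYT.map_length_rows, ← card_eq_sum_rowLens, t.card_shape]

theorem exists_tableauPair_rows_eq (π : GenPerm p q n) :
    ∃ t : TableauPair q p n, (t.P.rows, t.Q.rows) = rsk π := by
  obtain ⟨hP, hQ, hPQ⟩ := (rskList_spec π.isChain_columns).1
  obtain ⟨hp, hq⟩ := rskList_perm π.columns
  obtain ⟨P, hP'⟩ := hP.exists_rows_eq hP.rowLens_shape (m := q) (by
    intro e he
    rw [hp.mem_iff] at he
    simp only [GenPerm.columns, List.map_ofFn, List.mem_ofFn, Function.comp_apply] at he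
    obtain ⟨k, rfl⟩ := he
    exact (π.bot k).2)
  obtain ⟨Q, hQ'⟩ := hQ.exists_rows_eq (hP.rowLens_shape.trans hPQ) (m := p) (by
    intro e he
    rw [hq.mem_iff] at he
    simp only [GenPerm.columns, List.map_ofFn, List.mem_ofFn, Function.comp_apply] at he
    obtain ⟨k, rfl⟩ := he
    exact (π.top k).2)
  refine ⟨⟨hP.shape, ?_, P, Q⟩, Prod.ext hP' hQ'⟩
  rw [card_eq_sum_rowLens, hP.rowLens_shape, ← List.length_flatten, hp.length_eq]
  simp [GenPerm.columns]

theorem exists_rsk_eq (t : TableauPair q p n) :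
    ∃ π : GenPerm p q n, rsk π = (t.P.rows, t.Q.rows) := by
  obtain ⟨l, hl, he⟩ := exists_rskList_eq t.isTableauPair_rows
  obtain ⟨h1, h2⟩ := rskList_perm l
  rw [he] at h1 h2
  obtain ⟨π, rfl⟩ := GenPerm.exists_columns_eq (p := p) (q := q) (n := n) hl
    (by simpa [t.length_flatten_rows] using h1.length_eq.symm)
    (fun e h => t.Q.mem_rows_lt e (h2.mem_iff.2 h)) (fun e h => t.P.mem_rows_lt e (h1.mem_iff.2 h))
  exact ⟨π, he⟩

theorem exists_rsk_equiv (p q n : ℕ) :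
    ∃ Φ : GenPerm p q n ≃ TableauPair q p n, ∀ π, ((Φ π).P.rows, (Φ π).Q.rows) = rsk π := by
  choose φ hφ using fun π : GenPerm p q n => exists_tableauPair_rows_eq π
  refine ⟨Equiv.ofBijective φ ⟨fun π π' h => ?_, fun t => ?_⟩, hφ⟩
  · apply GenPerm.columns_injective
    apply rskList_injective π.isChain_columns π'.isChain_columns
    change rsk π = rsk π'
    rw [← hφ, ← hφ, h]
  · obtain ⟨π, hπ⟩ := exists_rsk_eq t
    have h := (hφ π).trans hπ
    exact ⟨π, TableauPair.ext_rows (congrArg Prod.fst h) (congrArg Prod.snd h)⟩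

end RSK

theorem theorem1p1 (p q n : ℕ) (hp : 0 < p) (hq : 0 < q) :
    (∃ (Φ : RSK.GenPerm p q n ≃ RSK.TableauPair q p n)
      (Ψ : RSK.GenPerm p q n ≃ RSK.NatMatrix p q n),
      (∀ π, ((Φ π).P.rows, (Φ π).Q.rows) = RSK.rsk π) ∧
      (∀ π i j, (Ψ π).1 i j = π.mult i j) ∧
      (∀ π, IsGreatest π.increasingLengths ((Φ π).shape.rowLen 0) ∧
        IsGreatest (RSK.pathWeights (Ψ π).1) ((Φ π).shape.rowLen 0))) ∧
    ((p * q + n - 1).choose n = Nat.card (RSK.GenPerm p q n) ∧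
      Nat.card (RSK.GenPerm p q n) =
        ∑ μ : RSK.Diagram n, RSK.schurAtOnes p μ.1 * RSK.schurAtOnes q μ.1 ∧
      ∑ μ : RSK.Diagram n, RSK.schurAtOnes p μ.1 * RSK.schurAtOnes q μ.1 =
        Nat.card (RSK.NatMatrix p q n)) := by
  obtain ⟨Φ, hΦ⟩ := RSK.exists_rsk_equiv p q n
  let Ψ : RSK.GenPerm p q n ≃ RSK.NatMatrix p q n :=
    Equiv.ofBijective _ RSK.GenPerm.toMatrix_bijective
  have hsum : Nat.card (RSK.GenPerm p q n) =
      ∑ μ : RSK.Diagram n, RSK.schurAtOnes p μ.1 * RSK.schurAtOnes q μ.1 := by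
    rw [Nat.card_congr Φ, RSK.natCard_tableauPair]
    -- `P` uses the alphabet of size `q` and `Q` that of size `p`, so the two factors come out in
    -- the opposite order.
    exact Finset.sum_congr rfl fun μ _ => mul_comm _ _
  have hmat : Nat.card (RSK.GenPerm p q n) = Nat.card (RSK.NatMatrix p q n) := Nat.card_congr Ψ
  refine ⟨⟨Φ, Ψ, hΦ, fun _ _ _ => rfl, fun π => ?_⟩,
    by rw [hmat, RSK.natCard_natMatrix], hsum, hsum.symm.trans hmat⟩
  have hlen : (Φ π).shape.rowLen 0 = ((RSK.rsk π).1.headD []).length := by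
    rw [← hΦ π, ← RSK.headD_map_length, RSK.BoundedSSYT.map_length_rows, RSK.rowLens_headD]
  have hinc := π.isGreatest_increasingLengths
  rw [← hlen] at hinc
  exact ⟨hinc, π.isGreatest_pathWeights hp hq hinc⟩
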